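/- Let $R_\alpha=\mathbb Z[\alpha_0,\alpha_1]$, $A_\alpha=R_\alpha[X]/((X-\alpha_0)(X-\alpha_1))$, regarded as a Frobenius algebra with trace $1\mapsto 0$, $X\mapsto 1$, so that $\Delta(1)=(X-\alpha_0)\otimes 1+1\otimes(X-\alpha_1)$ and $\Delta(X)=X\otimes X-\alpha_0\alpha_1\,1\otimes 1$. Let $\mathcal D=(\alpha_0-\alpha_1)^2$, $R_{\alpha\mathcal D}=R_\alpha[\mathcal D^{-1}]$, $A_{\alpha\mathcal D}=A_\alpha\otimes_{R_\alpha} R_{\alpha\mathcal D}$, and $$e_0=\frac{X-\alpha_0}{\alpha_1-\alpha_0},\qquad e_1=\frac{X-\alpha_1}{\alpha_0-\alpha_1}.$$ The quantum grading $\operatorname{qdeg}$ has $\deg\alpha_0=\deg\alpha_1=2$ (so $\deg \mathcal D^{-1}=-4$), and $\operatorname{qdeg}(1)=-1$, $\operatorname{qdeg}(X)=1$ for the module $A_\alpha$ of a circle. Let $D$ be a diagram of an oriented link in the thickened annulus, with $n_+$ positive and $n_-$ negative crossings. For a vertex $u$ of the cube of resolutions let $D_u$ be the corresponding smoothing, a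 collection of disjoint circles in the annulus. Let $\mathcal F_\alpha(D_u)$ be the tensor product over $R_\alpha$ of copies of $A_\alpha$, one for each circle of $D_u$, and for an edge $u\to v$ of the cube let $\mathcal F_\alpha(d_{u,v})$ be the multiplication or comultiplication of $A_\alpha$ applied to the circles that the saddle $d_{u,v}$ merges or splits. Number the essential (non-contractible) circles of $D_u$ by $1,2,\dots$ from the innermost to the outermost. Define an annular degree on $\mathcal F_\alpha(D_u)$: the factor of a trivial (contractible) circle has degree $0$; the factor of the $i$-th essential circle has the homogeneous basis $1$, $X-\alpha_0$ if $i$ is odd and $1$, $X-\alpha_1$ if $i$ is even, in annular degrees $-1$, $1$. Let $\mathcal G_\alpha(D_u)=\mathcal F_\alpha(D_u)$, and let $\mathcal G_\alpha(d_{u,v})$ be the part of $\mathcal F_\alpha(d_{u,v})$ that preserves the annular degree. Let $\mathcal F_{\alpha\mathcal D}$ and $\mathcal G_{\alpha\mathcal D}$ denote the results of extending scalars to $R_{\alpha\mathcal D}$. Fix signs $\pm1$ on the edges of the cube that make its commutative squares anti-commute. For $\mathcal H=\mathcal F_{\alpha\mathcal D}$ and $\mathcal H=\mathcal G_{\alpha\mathcal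 D}$ put in homological degree $i$ the module $\bigoplus_{|u|=i+n_-}\mathcal H(D_u)\{n_--n_+-i\}$ ($\{m\}$ shifts $\operatorname{qdeg}$ upwards by $m$), with the signed sum of the maps $\mathcal H(d_{u,v})$ as differential. Call the results $CKh_{\alpha\mathcal D}(D)$ (the planar complex, of $D$ viewed in $\mathbb R^2$) and $CKh^{\mathbb A}_{\alpha\mathcal D}(D)$ (the annular complex). A labelling of the circles of $D_u$ by $\mathbf a$ and $\mathbf b$ determines an element of $\mathcal G_{\alpha\mathcal D}(D_u)$, the tensor product of the following elements: $\mathbf a\leftrightarrow e_0$, $\mathbf b\leftrightarrow e_1$ at a trivial circle; $\mathbf a\leftrightarrow \frac{X-\alpha_0}{\alpha_1-\alpha_0}$, $\mathbf b\leftrightarrow 1$ at the $i$-th essential circle, $i$ odd; $\mathbf a\leftrightarrow 1$, $\mathbf b\leftrightarrow \frac{X-\alpha_1}{\alpha_0-\alpha_1}$ at the $i$-th essential circle, $i$ even. **Theorem.** Both $CKh^{\mathbb A}_{\alpha\mathcal D}(D)$ and $CKh_{\alpha\mathcal D}(D)$ are cochain complexes. For each smoothing $D_u$ the elements given by the $\mathbf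 a/\mathbf b$-labellings form an $R_{\alpha\mathcal D}$-basis of $\mathcal G_{\alpha\mathcal D}(D_u)$, and the tensor products of $e_0$s and $e_1$s form an $R_{\alpha\mathcal D}$-basis of $\mathcal F_{\alpha\mathcal D}(D_u)$. There is an isomorphism of complexes of $R_{\alpha\mathcal D}$-modules $$\varphi\colon CKh^{\mathbb A}_{\alpha\mathcal D}(D)\xrightarrow{\ \sim\ } CKh_{\alpha\mathcal D}(D)$$ that preserves the homological degree and $\operatorname{qdeg}$, and that maps, for each smoothing $D_u$, the element given by a labelling to the tensor product with $e_0$ at each circle labelled $\mathbf a$ and $e_1$ at each circle labelled $\mathbf b$. -/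

import Mathlib

open scoped TensorProduct DirectSum

noncomputable section

/-! ## Annular link diagrams

Links and their diagrams are taken up to isotopy, so a diagram may be drawn on the square grid.
The annulus is the plane minus the point `(1/2, 1/2)`, which is the centre of a grid cell.
A diagram runs along grid edges; it passes straight on or turns at a grid point of degree two,
and it has a crossing at a grid point of degree four.  Every oriented link diagram in the annulus
is isotopic (in the annulus) to one of this form. -/

/-- The four directions at a grid point. -/
inductive Dir
  | east | north | west | south
  deriving DecidableEq

/-- A grid edge `(p, false)` joins `p` to `p + (1, 0)`, and `(p, true)` joins `p` to `p + (0, 1)`. -/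
abbrev GridEdge : Type := (ℤ × ℤ) × Bool

/-- The grid edge that leaves the grid point `v` in direction `d`. -/
def edgeAt (v : ℤ × ℤ) : Dir → GridEdge
  | Dir.east => (v, false)
  | Dir.north => (v, true)
  | Dir.west => ((v.1 - 1, v.2), false)
  | Dir.south => ((v.1, v.2 - 1), true)

/-- `1` if the standard (eastward or northward) orientation of the edge leaving a grid point in
direction `d` points away from the grid point, and `-1` otherwise. -/
def Dir.sign : Dir → SignType
  | Dir.east => 1
  | Dir.north => 1
  | Dir.west => -1
  | Dir.south => -1

/-- Coming in along direction `d` at a crossing, the direction along which a smoothing leaves: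
`true` is the smoothing with arcs north-east and west-south, `false` is the smoothing with arcs
north-west and east-south. -/
def Dir.partner : Bool → Dir → Dir
  | true, Dir.east => Dir.north
  | true, Dir.north => Dir.east
  | true, Dir.west => Dir.south
  | true, Dir.south => Dir.west
  | false, Dir.east => Dir.south
  | false, Dir.south => Dir.east
  | false, Dir.west => Dir.north
  | false, Dir.north => Dir.west

/-- An oriented link diagram in the annulus `ℝ² ∖ {(1/2, 1/2)}`, drawn on the grid. -/
structure AnnularDiagram where
  /-- `0` off the diagram; on an edge of the diagram, `1` if the orientation of the link is
  eastward or northward there, and `-1` if it is westward or southward. -/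
  flow : GridEdge → SignType
  finite_flow : (Function.support flow).Finite
  /-- At each grid point there is either nothing, or one strand that comes in along one direction
  and goes out along another one, or a crossing of two straight strands. -/
  local_form : ∀ v : ℤ × ℤ,
    (∀ d, d.sign * flow (edgeAt v d) = 0) ∨
    (∃ d d' : Dir, d.sign * flow (edgeAt v d) = 1 ∧ d'.sign * flow (edgeAt v d') = -1 ∧
      ∀ d'', d'' ≠ d → d'' ≠ d' → flow (edgeAt v d'') = 0) ∨
    ((∀ d, flow (edgeAt v d) ≠ 0) ∧
      flow (edgeAt v Dir.east) = flow (edgeAt v Dir.west) ∧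
      flow (edgeAt v Dir.north) = flow (edgeAt v Dir.south))
  /-- `true` if the horizontal strand is the upper one; it matters at the crossings only. -/
  horizontalOver : ℤ × ℤ → Bool

namespace AnnularDiagram

variable (D : AnnularDiagram)

/-- The grid edges of the diagram. -/
def Arc : Type := {e : GridEdge // D.flow e ≠ 0}

/-- The crossings of the diagram. -/
def Crossing : Type := {v : ℤ × ℤ // ∀ d, D.flow (edgeAt v d) ≠ 0}

instance : Finite D.Arc := by
  have h : {e : GridEdge | D.flow e ≠ 0}.Finite := D.finite_flow
  exact h.to_subtype

instance : Fintype D.Arc := Fintype.ofFinite _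

instance : Finite D.Crossing := by
  refine Finite.of_injective (β := D.Arc)
    (fun p : D.Crossing => ⟨edgeAt p.1 Dir.east, p.2 _⟩) ?_
  intro p q h
  have h' := congrArg (fun e : D.Arc => e.1.1) h
  exact Subtype.ext h'

instance : Fintype D.Crossing := Fintype.ofFinite _

instance : DecidableEq D.Crossing := Classical.decEq _

/-- The edge of the diagram that leaves a crossing in a given direction. -/
def arcAt (p : D.Crossing) (d : Dir) : D.Arc := ⟨edgeAt p.1 d, p.2 d⟩

/-- A crossing is positive if (direction of the upper strand, direction of the lower strand)
is a positive basis of the plane. -/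
def IsPositive (p : D.Crossing) : Prop :=
  (if D.horizontalOver p.1 then (1 : SignType) else -1) *
    (D.flow (edgeAt p.1 Dir.east) * D.flow (edgeAt p.1 Dir.north)) = 1

/-- The number of positive crossings. -/
def nPlus : ℕ := Nat.card {p : D.Crossing // D.IsPositive p}

/-- The number of negative crossings. -/
def nMinus : ℕ := Nat.card {p : D.Crossing // ¬ D.IsPositive p}

/-! ## Smoothings -/

/-- A vertex of the cube of resolutions: `false` is the 0-smoothing and `true` the 1-smoothing. -/
abbrev State : Type := D.Crossing → Bool

/-- The sum of the entries of `u`. -/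
def weight (u : D.State) : ℕ := (Finset.univ.filter fun p => u p = true).card

variable {D}

/-- The smoothing of the diagram at `u` joins the edges that leave `v` in the directions `d`
and `d'`.  The 0-smoothing joins the two regions that the upper strand sweeps out when it is
rotated counterclockwise: north-east and south-west if the upper strand is horizontal. -/
def Joined (u : D.State) (v : ℤ × ℤ) (d d' : Dir) : Prop :=
  D.flow (edgeAt v d) ≠ 0 ∧ D.flow (edgeAt v d') ≠ 0 ∧ d ≠ d' ∧
    ∀ h : ∀ d, D.flow (edgeAt v d) ≠ 0, d' = Dir.partner (u ⟨v, h⟩ == D.horizontalOver v) d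

/-- Two edges of the diagram are joined at a grid point in the smoothing at `u`. -/
def ArcJoined (u : D.State) (e f : D.Arc) : Prop :=
  ∃ v d d', Joined u v d d' ∧ e.1 = edgeAt v d ∧ f.1 = edgeAt v d'

/-- The circles of the smoothing `D_u`. -/
def Circle (u : D.State) : Type := Quot (ArcJoined u)

/-- The circle of `D_u` that contains a given edge. -/
def circleOf (u : D.State) (e : D.Arc) : Circle u := Quot.mk _ e

instance (u : D.State) : Finite (Circle u) := inferInstanceAs (Finite (Quot _))

instance (u : D.State) : Fintype (Circle u) := Fintype.ofFinite _

instance (u : D.State) : DecidableEq (Circle u) := Classical.decEq _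

/-- The ray that goes east from the puncture crosses the `n`-th edge of the following form. -/
def rayEdge (n : ℕ) : GridEdge := (((n : ℤ) + 1, 0), true)

/-- An orientation of the edges of a circle `C` that fits together at each grid point; `o e` tells
whether the edge `e` has the standard (eastward or northward) orientation. -/
def IsCoherent {u : D.State} (C : Circle u) (o : D.Arc → SignType) : Prop :=
  (∀ e, o e ≠ 0) ∧
    ∀ (e f : D.Arc) (v : ℤ × ℤ) (d d' : Dir), Joined u v d d' → e.1 = edgeAt v d →
      f.1 = edgeAt v d' → circleOf u e = C → d.sign * o e = -(d'.sign * o f)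

open scoped Classical in
/-- The winding number of an oriented circle around the puncture: the signed number of its
crossings with the ray from the puncture to infinity. -/
def winding {u : D.State} (C : Circle u) (o : D.Arc → SignType) : ℤ :=
  ∑ e : D.Arc, if circleOf u e = C ∧ ∃ n, e.1 = rayEdge n then ((o e : SignType) : ℤ) else 0

/-- A circle is essential if it is not contractible in the annulus, i.e. it has nonzero winding
number (for either of its orientations); otherwise it is trivial. -/
def IsEssential {u : D.State} (C : Circle u) : Prop :=
  ∃ o, IsCoherent C o ∧ winding C o ≠ 0

/-- The place where the ray from the puncture first meets a circle (which it does if the circle is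
essential). -/
def firstHit {u : D.State} (C : Circle u) : ℕ :=
  sInf {n : ℕ | ∃ e : D.Arc, e.1 = rayEdge n ∧ circleOf u e = C}

/-- The essential circles are nested around the puncture.  They are numbered `1, 2, …` from the
innermost one outwards; this is the number of `C`. -/
def essentialIndex {u : D.State} (C : Circle u) : ℕ :=
  1 + Nat.card {C' : Circle u // IsEssential C' ∧ firstHit C' < firstHit C}

end AnnularDiagram

/-! ## The Frobenius algebra -/

/-- `ℤ[α₀, α₁]`. -/
abbrev Rα : Type := MvPolynomial (Fin 2) ℤ

/-- The variables `α₀`, `α₁`. -/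
def α (i : Fin 2) : Rα := MvPolynomial.X i

/-- The polynomial `(X - α₀)(X - α₁)`. -/
def quadα : Polynomial Rα :=
  (Polynomial.X - Polynomial.C (α 0)) * (Polynomial.X - Polynomial.C (α 1))

/-- `A_α = R_α[X] / ((X - α₀)(X - α₁))`. -/
abbrev Aα : Type := AdjoinRoot quadα

/-- The class of `X` in `A_α`. -/
def Xα : Aα := AdjoinRoot.root quadα

theorem quadα_monic : quadα.Monic :=
  (Polynomial.monic_X_sub_C _).mul (Polynomial.monic_X_sub_C _)

theorem quadα_natDegree : quadα.natDegree = 2 := by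
  unfold quadα
  rw [Polynomial.Monic.natDegree_mul (Polynomial.monic_X_sub_C _) (Polynomial.monic_X_sub_C _)]
  simp

/-- The basis `{1, X}` of `A_α`. -/
def basisX : Module.Basis (Fin 2) Rα Aα :=
  (AdjoinRoot.powerBasis' quadα_monic).basis.reindex (finCongr quadα_natDegree)

theorem basisX_zero : basisX 0 = 1 := by
  rw [basisX, Module.Basis.reindex_apply, PowerBasis.basis_eq_pow]
  exact pow_zero _

theorem basisX_one : basisX 1 = Xα := by
  rw [basisX, Module.Basis.reindex_apply, PowerBasis.basis_eq_pow]
  exact pow_one _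

/-- The basis `{1, X - r}` of `A_α`, for `r` in `R_α`. -/
def basisXSub (r : Rα) : Module.Basis (Fin 2) Rα Aα :=
  Module.Basis.mk (v := ![1, Xα - algebraMap Rα Aα r])
    (by
      have h : LinearIndependent Rα ![(1 : Aα), Xα] := by
        have h1 := basisX.linearIndependent
        have h2 : (⇑basisX : Fin 2 → Aα) = ![1, Xα] := by
          funext i
          fin_cases i
          · exact basisX_zero
          · exact basisX_one
        rwa [h2] at h1
      have h3 := (LinearIndependent.pair_add_smul_right_iff (-r)).2 h
      rwa [neg_smul, ← Algebra.algebraMap_eq_smul_one, add_comm, ← sub_eq_add_neg] at h3)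
    (by
      rw [← basisX.span_eq, Submodule.span_le]
      have h1 : (1 : Aα) ∈ Submodule.span Rα (Set.range ![1, Xα - algebraMap Rα Aα r]) :=
        Submodule.subset_span ⟨0, rfl⟩
      have h2 : Xα - algebraMap Rα Aα r ∈
          Submodule.span Rα (Set.range ![1, Xα - algebraMap Rα Aα r]) :=
        Submodule.subset_span ⟨1, rfl⟩
      rintro _ ⟨i, rfl⟩
      fin_cases i
      · change basisX 0 ∈ _
        rw [basisX_zero]
        exact h1
      · change basisX 1 ∈ _
        rw [basisX_one]
        have h3 := Submodule.add_mem _ h2 (Submodule.smul_mem _ r h1)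
        rwa [← Algebra.algebraMap_eq_smul_one, sub_add_cancel] at h3)

/-- The comultiplication `1 ↦ (X - α₀) ⊗ 1 + 1 ⊗ (X - α₁)`, `X ↦ X ⊗ X - α₀ α₁ 1 ⊗ 1`. -/
def comulα : Aα →ₗ[Rα] Aα ⊗[Rα] Aα :=
  basisX.constr Rα
    ![(Xα - algebraMap Rα Aα (α 0)) ⊗ₜ 1 + 1 ⊗ₜ (Xα - algebraMap Rα Aα (α 1)),
      Xα ⊗ₜ Xα - (α 0 * α 1) • (1 ⊗ₜ 1)]

namespace AnnularDiagram

variable {D : AnnularDiagram}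

/-! ## The planar TQFT -/

/-- The module `F_α(D_u) = A_α^{⊗ circles of D_u}`. -/
abbrev TQFT (u : D.State) : Type := ⨂[Rα] _ : Circle u, Aα

/-- The basis of `F_α(D_u)` that consists of the tensor products of `1`s and `X`s. -/
def stdBasis (u : D.State) : Module.Basis (Circle u → Fin 2) Rα (TQFT u) :=
  Basis.piTensorProduct fun _ => basisX

open scoped Classical in
/-- The map that multiplies the factors of all circles of `D_u` that lie on the same circle
of `D_v`; it is the map of a saddle that merges two circles. -/
def mergeMap (u v : D.State) : TQFT u →ₗ[Rα] TQFT v :=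
  (stdBasis u).constr Rα fun l =>
    ⨂ₜ[Rα] c : Circle v,
      ∏ k : Circle u with ∃ e, circleOf u e = k ∧ circleOf v e = c, basisX (l k)

/-- The linear map `y ⊗ z ↦ (x with y inserted at c and z inserted at d)`. -/
def insertTwo {v : D.State} (c d : Circle v) (h : c ≠ d) (x : Circle v → Aα) :
    Aα ⊗[Rα] Aα →ₗ[Rα] TQFT v :=
  TensorProduct.lift <| LinearMap.mk₂ Rα
    (fun y z => PiTensorProduct.tprod Rα (Function.update (Function.update x c y) d z))
    (fun y y' z => by
      simp only [Function.update_comm h, MultilinearMap.map_update_add])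
    (fun r y z => by
      simp only [Function.update_comm h, MultilinearMap.map_update_smul])
    (fun y z z' => by simp only [MultilinearMap.map_update_add])
    (fun r y z => by simp only [MultilinearMap.map_update_smul])

/-- The map of a saddle that splits a circle `a` of `D_u` into the two circles `c`, `d` of `D_v`:
the comultiplication on the factor of `a`, the identity on the factors of the other circles
(which have the same edges in `D_u` and in `D_v`). -/
def splitMap (u v : D.State) (a : Circle u) (c d : Circle v) (h : c ≠ d) :
    TQFT u →ₗ[Rα] TQFT v :=
  (stdBasis u).constr Rα fun l =>
    insertTwo c d h (fun k => basisX (l (circleOf u (Quot.out k)))) (comulα (basisX (l a)))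

/-- The vertex of the cube with the entry at the crossing `p` changed to `1`. -/
def raise (u : D.State) (p : D.Crossing) : D.State := Function.update u p true

open scoped Classical in
/-- The map `F_α(d_{u,v})` of the saddle at the crossing `p`, where `u p = 0` and `v = raise u p`.
The two arcs of `D_u` at `p`, and also those of `D_v`, are the one that contains the eastern edge
and the one that contains the western edge.  The saddle merges two circles, or it splits one circle
(nothing else can happen in the plane, so the last value is never used). -/
def saddle (u : D.State) (p : D.Crossing) : TQFT u →ₗ[Rα] TQFT (raise u p) :=
  if circleOf u (D.arcAt p Dir.east) ≠ circleOf u (D.arcAt p Dir.west) then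
    mergeMap u (raise u p)
  else if h : circleOf (raise u p) (D.arcAt p Dir.east) ≠
      circleOf (raise u p) (D.arcAt p Dir.west) then
    splitMap u (raise u p) (circleOf u (D.arcAt p Dir.east)) _ _ h
  else 0

/-! ## The annular TQFT -/

open scoped Classical in
/-- The homogeneous basis of the factor of a circle in the annular theory: `{1, X}` for a trivial
circle, `{1, X - α₀}` for an essential circle with odd number, `{1, X - α₁}` for an essential
circle with even number. -/
def circleBasis {u : D.State} (C : Circle u) : Module.Basis (Fin 2) Rα Aα :=
  if IsEssential C then
    if Odd (essentialIndex C) then basisXSub (α 0) else basisXSub (α 1)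
  else basisX

/-- The tensor product of the bases `circleBasis`. -/
def annularBasis (u : D.State) : Module.Basis (Circle u → Fin 2) Rα (TQFT u) :=
  Basis.piTensorProduct fun C => circleBasis C

open scoped Classical in
/-- The annular degree of an element of `annularBasis`: a trivial circle counts `0`, an essential
circle counts `-1` for `1` and `1` for `X - α_i`. -/
def adeg (u : D.State) (l : Circle u → Fin 2) : ℤ :=
  ∑ C : Circle u, if IsEssential C then (if l C = 0 then -1 else 1) else 0

open scoped Classical in
/-- The part of a linear map that preserves the annular degree. -/
def adegPart {u v : D.State} (f : TQFT u →ₗ[Rα] TQFT v) : TQFT u →ₗ[Rα] TQFT v :=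
  (annularBasis u).constr Rα fun l =>
    ∑ m : Circle v → Fin 2,
      if adeg v m = adeg u l then
        (annularBasis v).repr (f (annularBasis u l)) m • annularBasis v m
      else 0

/-- The map `G_α(d_{u,v})`: the part of `F_α(d_{u,v})` that preserves the annular degree.  The
module `G_α(D_u)` is `F_α(D_u)`, with the annular degree as an additional grading. -/
def annularSaddle (u : D.State) (p : D.Crossing) : TQFT u →ₗ[Rα] TQFT (raise u p) :=
  adegPart (saddle u p)

end AnnularDiagram

/-! ## Inverting the discriminant -/

/-- The discriminant `(α₀ - α₁)²`. -/
def discr : Rα := (α 0 - α 1) ^ 2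

/-- `R_{αD} = R_α[discr⁻¹]`. -/
def RαD : Type := Localization.Away discr

instance : CommRing RαD := inferInstanceAs (CommRing (Localization.Away discr))

instance : Algebra Rα RαD := inferInstanceAs (Algebra Rα (Localization.Away discr))

instance : IsLocalization.Away discr RαD :=
  inferInstanceAs (IsLocalization.Away discr (Localization.Away discr))

/-- The elements `1 / (α₁ - α₀)` (for `i = 0`) and `1 / (α₀ - α₁)` (for `i = 1`) of `R_{αD}`. -/
def invDiff (i : Fin 2) : RαD := Ring.inverse (algebraMap Rα RαD (α (1 - i) - α i))

theorem isUnit_diff (i : Fin 2) : IsUnit (algebraMap Rα RαD (α (1 - i) - α i)) := by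
  have h : IsUnit (algebraMap Rα RαD discr) := IsLocalization.Away.algebraMap_isUnit discr
  have h2 : discr = (α (1 - i) - α i) ^ 2 := by
    fin_cases i
    · change (α 0 - α 1) ^ 2 = (α 1 - α 0) ^ 2
      ring
    · rfl
  rw [h2, map_pow] at h
  exact (isUnit_pow_iff two_ne_zero).1 h

/-- An element of `R_{αD}` is homogeneous of degree `k`; `α₀` and `α₁` have degree `2`, so the
discriminant has degree `4`. -/
def IsHomogeneousRαD (r : RαD) (k : ℤ) : Prop :=
  ∃ (n m : ℕ) (f : Rα), f.IsHomogeneous m ∧ k = 2 * m - 4 * n ∧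
    r * algebraMap Rα RαD (discr ^ n) = algebraMap Rα RαD f

namespace AnnularDiagram

variable {D : AnnularDiagram}

/-- The module `F_{αD}(D_u) = R_{αD} ⊗ F_α(D_u)`, which is also the module `G_{αD}(D_u)`. -/
abbrev TQFTD (u : D.State) : Type := RαD ⊗[Rα] TQFT u

/-- The tensor product over the circles of `D_u` of the elements `(s C) * (x C)` of
`A_{αD} = R_{αD} ⊗ A_α`, as an element of `R_{αD} ⊗ F_α(D_u)`. -/
def pureTensor {u : D.State} (s : Circle u → RαD) (x : Circle u → Aα) : TQFTD u :=
  (∏ C, s C) ⊗ₜ[Rα] (⨂ₜ[Rα] C, x C)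

/-- The tensor product of the elements `e₀ = (X - α₀)/(α₁ - α₀)` and `e₁ = (X - α₁)/(α₀ - α₁)`
of `A_{αD}`, with `e_{l C}` at the circle `C`. -/
def planarGenerator (u : D.State) (l : Circle u → Fin 2) : TQFTD u :=
  pureTensor (fun C => invDiff (l C)) (fun C => Xα - algebraMap Rα Aα (α (l C)))

open scoped Classical in
/-- The scalar and the vector of the element of `A_{αD}` that corresponds to a label of a circle,
where `0` is the label `a` and `1` is the label `b`.  A trivial circle has `e₀` for `a` and `e₁`
for `b`.  An essential circle with odd number has `(X - α₀)/(α₁ - α₀)` for `a` and `1` for `b`.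
An essential circle with even number has `1` for `a` and `(X - α₁)/(α₀ - α₁)` for `b`. -/
def labelElement {u : D.State} (C : Circle u) (i : Fin 2) : RαD × Aα :=
  if IsEssential C then
    if Odd (essentialIndex C) then
      (if i = 0 then (invDiff 0, Xα - algebraMap Rα Aα (α 0)) else (1, 1))
    else
      (if i = 0 then (1, 1) else (invDiff 1, Xα - algebraMap Rα Aα (α 1)))
  else (invDiff i, Xα - algebraMap Rα Aα (α i))

/-- The element of `G_{αD}(D_u)` given by a labelling of the circles of `D_u` by `a` (`0`) and
`b` (`1`). -/
def annularGenerator (u : D.State) (l : Circle u → Fin 2) : TQFTD u :=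
  pureTensor (fun C => (labelElement C (l C)).1) (fun C => (labelElement C (l C)).2)

/-- The elements of quantum degree `k`: sums of `r ⊗ x` where `x` is a tensor product of `1`s
(of degree `-1`) and `X`s (of degree `1`), `r` in `R_{αD}` is homogeneous, and the degrees add up
to `k`. -/
def qdegPiece (u : D.State) (k : ℤ) : AddSubgroup (TQFTD u) :=
  AddSubgroup.closure {z | ∃ (r : RαD) (j : ℤ) (l : Circle u → Fin 2), IsHomogeneousRαD r j ∧
    k = j + ∑ C, (if l C = 0 then -1 else 1) ∧ z = r ⊗ₜ[Rα] stdBasis u l}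

/-! ## The chain complexes -/

theorem weight_raise {u : D.State} {p : D.Crossing} (h : u p = false) :
    D.weight (raise u p) = D.weight u + 1 := by
  unfold weight raise
  have h1 : (Finset.univ.filter fun q => Function.update u p true q = true) =
      insert p (Finset.univ.filter fun q => u q = true) := by
    ext q
    by_cases hq : q = p
    · subst hq
      simp
    · simp [hq]
  rw [h1, Finset.card_insert_of_notMem (by simp [h])]

variable (D)

/-- A choice of signs that makes the commutative cube of resolutions anti-commutative; `s u p` is
the sign of the edge from `u` to `raise u p`, used only if `u p = 0`. -/
structure SignAssignment where
  sign : D.State → D.Crossing → ℤˣ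
  anticomm : ∀ (u : D.State) (p q : D.Crossing), p ≠ q → u p = false → u q = false →
    sign u p * sign (raise u p) q = -(sign u q * sign (raise u q) p)

/-- Signs exist: number the crossings, and let the sign be given by the parity of the number of
entries `1` before the entry that is changed. -/
theorem signAssignment_nonempty : Nonempty D.SignAssignment := by
  classical
  obtain ⟨n, ⟨e⟩⟩ := Finite.exists_equiv_fin D.Crossing
  let N : D.State → D.Crossing → Finset D.Crossing := fun u p =>
    Finset.univ.filter fun r => e r < e p ∧ u r = true
  have h1 : ∀ u p q, ¬ e p < e q → N (raise u p) q = N u q := by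
    intro u p q h
    ext r
    by_cases hr : r = p
    · subst hr
      simp [N, h]
    · simp [N, raise, hr]
  have h2 : ∀ u p q, u p = false → e p < e q →
      (N (raise u p) q).card = (N u q).card + 1 := by
    intro u p q h hpq
    have h3 : N (raise u p) q = insert p (N u q) := by
      ext r
      by_cases hr : r = p
      · subst hr
        simp [N, raise, hpq]
      · simp [N, raise, hr]
    rw [h3, Finset.card_insert_of_notMem (by simp [N, h])]
  refine ⟨⟨fun u p => (-1) ^ (N u p).card, ?_⟩⟩
  intro u p q hpq hp hq
  rcases lt_trichotomy (e p) (e q) with h | h | h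
  · rw [h2 u p q hp h, h1 u q p (not_lt.2 h.le), pow_succ]
    simp [mul_comm]
  · exact absurd (e.injective h) hpq
  · rw [h2 u q p hq h, h1 u p q (not_lt.2 h.le), pow_succ]
    simp [mul_comm]

/-- The vertices of the cube that contribute to homological degree `i`. -/
def StateInDegree (i : ℤ) : Type := {u : D.State // (D.weight u : ℤ) = i + D.nMinus}

instance (i : ℤ) : DecidableEq (D.StateInDegree i) := Classical.decEq _

/-- The chain module in homological degree `i`, for the planar and for the annular theory. -/
abbrev Chain (i : ℤ) : Type := ⨁ u : D.StateInDegree i, TQFTD u.1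

variable {D}

/-- The vertex `raise u p`, in the next homological degree. -/
def StateInDegree.raise {i : ℤ} (u : D.StateInDegree i) (p : {p : D.Crossing // u.1 p = false}) :
    D.StateInDegree (i + 1) :=
  ⟨AnnularDiagram.raise u.1 p.1, by
    rw [weight_raise p.2]
    push_cast
    rw [u.2]
    ring⟩

/-- The differential, with given maps for the edges of the cube: the signed sum of the edge maps,
after extension of scalars to `R_{αD}`. -/
def cubeDiff (s : D.SignAssignment)
    (f : ∀ (u : D.State) (p : D.Crossing), TQFT u →ₗ[Rα] TQFT (raise u p)) (i : ℤ) :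
    D.Chain i →ₗ[RαD] D.Chain (i + 1) :=
  DirectSum.toModule RαD _ _ fun u =>
    ∑ p : {p : D.Crossing // u.1 p = false},
      ((s.sign u.1 p.1 : ℤ) : RαD) •
        (DirectSum.lof RαD (D.StateInDegree (i + 1)) (fun v => TQFTD v.1) (u.raise p) ∘ₗ
          (f u.1 p.1).baseChange RαD)

/-- The differential of `CKh_{αD}(D)`. -/
def planarDiff (s : D.SignAssignment) (i : ℤ) : D.Chain i →ₗ[RαD] D.Chain (i + 1) :=
  cubeDiff s saddle i

/-- The differential of the annular complex of `D`. -/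
def annularDiff (s : D.SignAssignment) (i : ℤ) : D.Chain i →ₗ[RαD] D.Chain (i + 1) :=
  cubeDiff s annularSaddle i

/-- A chain of homological degree `i` has quantum degree `k`; the summands are shifted upwards by
`n₋ - n₊ - i`. -/
def HasQdeg {i : ℤ} (k : ℤ) (x : D.Chain i) : Prop :=
  ∀ u : D.StateInDegree i, x u ∈ qdegPiece u.1 (k - (D.nMinus - D.nPlus - i))

/-- The inclusion of the summand of `u`. -/
abbrev inclusion {i : ℤ} (u : D.StateInDegree i) : TQFTD u.1 →ₗ[RαD] D.Chain i :=
  DirectSum.lof RαD (D.StateInDegree i) (fun v => TQFTD v.1) u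

end AnnularDiagram

end

noncomputable section

/-! ## Potentials of flows on the grid -/

/-- The grid cell on the left of an edge with its standard orientation; `(x, y)` is the cell with
lower left corner `(x, y)`. -/
def leftCell (e : GridEdge) : ℤ × ℤ := if e.2 then (e.1.1 - 1, e.1.2) else e.1

/-- The grid cell on the right of an edge with its standard orientation. -/
def rightCell (e : GridEdge) : ℤ × ℤ := if e.2 then e.1 else (e.1.1, e.1.2 - 1)

/-- The cell counterclockwise of the edge that leaves `v` in a given direction. -/
def ccwCell (v : ℤ × ℤ) : Dir → ℤ × ℤ
  | Dir.east => v
  | Dir.north => (v.1 - 1, v.2)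
  | Dir.west => (v.1 - 1, v.2 - 1)
  | Dir.south => (v.1, v.2 - 1)

/-- The cell clockwise of the edge that leaves `v` in a given direction. -/
def cwCell (v : ℤ × ℤ) : Dir → ℤ × ℤ
  | Dir.east => (v.1, v.2 - 1)
  | Dir.north => v
  | Dir.west => (v.1 - 1, v.2)
  | Dir.south => (v.1 - 1, v.2 - 1)

/-- The sum of the outgoing amounts is zero at each grid point. -/
def DivFree (Φ : GridEdge → ℤ) : Prop :=
  ∀ v, Φ (edgeAt v Dir.east) + Φ (edgeAt v Dir.north) =
    Φ (edgeAt v Dir.west) + Φ (edgeAt v Dir.south)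

/-- The winding number of a flow around a cell. -/
def potential (Φ : GridEdge → ℤ) (c : ℤ × ℤ) : ℤ := ∑' n : ℕ, Φ ((c.1 + 1 + n, c.2), true)

/-- Each row of `W` is zero far in the east. -/
def VanishesEast (W : ℤ × ℤ → ℤ) : Prop := ∀ j, ∃ N, ∀ i ≥ N, W (i, j) = 0

theorem summable_ray {Φ : GridEdge → ℤ} (hΦ : (Function.support Φ).Finite) (i j : ℤ) (b : Bool) :
    Summable fun n : ℕ => Φ ((i + n, j), b) := by
  refine summable_of_hasFiniteSupport ?_
  refine hΦ.preimage (f := fun n : ℕ => (((i + n, j), b) : GridEdge)) ?_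
  intro m _ n _ h
  simpa using h

theorem potential_jump_vertical {Φ : GridEdge → ℤ} (hΦ : (Function.support Φ).Finite) (x y : ℤ) :
    potential Φ (x - 1, y) - potential Φ (x, y) = Φ ((x, y), true) := by
  unfold potential
  have h := (summable_ray hΦ x y true).tsum_eq_zero_add
  simp only [sub_add_cancel]
  rw [h]
  simp only [Nat.cast_zero, add_zero, Nat.cast_add, Nat.cast_one]
  rw [add_sub_assoc, sub_eq_zero.2, add_zero]
  exact tsum_congr fun n => by rw [show x + (n + 1 : ℤ) = x + 1 + n by ring]

theorem potential_jump_horizontal {Φ : GridEdge → ℤ} (hΦ : (Function.support Φ).Finite)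
    (hdiv : DivFree Φ) (x y : ℤ) :
    potential Φ (x, y) - potential Φ (x, y - 1) = Φ ((x, y), false) := by
  unfold potential
  rw [← (summable_ray hΦ (x + 1) y true).tsum_sub (summable_ray hΦ (x + 1) (y - 1) true)]
  have h1 : ∀ n : ℕ, Φ ((x + 1 + n, y), true) - Φ ((x + 1 + n, y - 1), true) =
      Φ ((x + n, y), false) - Φ ((x + 1 + n, y), false) := by
    intro n
    have := hdiv (x + 1 + n, y)
    simp only [edgeAt] at this
    rw [show x + 1 + (n : ℤ) - 1 = x + n by ring] at this
    linarith
  rw [tsum_congr h1, (summable_ray hΦ x y false).tsum_sub (summable_ray hΦ (x + 1) y false),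
    (summable_ray hΦ x y false).tsum_eq_zero_add]
  simp only [Nat.cast_zero, add_zero, Nat.cast_add, Nat.cast_one]
  rw [add_sub_assoc, sub_eq_zero.2, add_zero]
  exact tsum_congr fun n => by rw [show x + (n + 1 : ℤ) = x + 1 + n by ring]

theorem potential_jump {Φ : GridEdge → ℤ} (hΦ : (Function.support Φ).Finite)
    (hdiv : DivFree Φ) (e : GridEdge) :
    potential Φ (leftCell e) - potential Φ (rightCell e) = Φ e := by
  obtain ⟨⟨x, y⟩, b⟩ := e
  cases b
  · simpa [leftCell, rightCell] using potential_jump_horizontal hΦ hdiv x y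
  · simpa [leftCell, rightCell] using potential_jump_vertical hΦ x y

theorem potential_vanishesEast {Φ : GridEdge → ℤ} (hΦ : (Function.support Φ).Finite) :
    VanishesEast (potential Φ) := by
  intro j
  obtain ⟨N, hN⟩ := (hΦ.image fun e => e.1.1).bddAbove
  refine ⟨N, fun i hi => ?_⟩
  unfold potential
  rw [tsum_congr (g := fun _ => (0 : ℤ)), tsum_zero]
  intro n
  by_contra h
  have := hN ⟨_, h, rfl⟩
  simp only at this
  omega

theorem jump_around {W : ℤ × ℤ → ℤ} {Φ : GridEdge → ℤ}
    (h : ∀ e, W (leftCell e) - W (rightCell e) = Φ e) (v : ℤ × ℤ) (d : Dir) :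
    W (ccwCell v d) - W (cwCell v d) = (d.sign : ℤ) * Φ (edgeAt v d) := by
  have := h (edgeAt v d)
  cases d <;> simp [edgeAt, leftCell, rightCell, ccwCell, cwCell, Dir.sign] at this ⊢ <;> linarith

theorem eq_of_no_jump {W : ℤ × ℤ → ℤ} (hW : VanishesEast W)
    (h : ∀ e, W (leftCell e) = W (rightCell e)) (c : ℤ × ℤ) : W c = 0 := by
  obtain ⟨i, j⟩ := c
  have h1 : ∀ n : ℕ, W (i, j) = W (i + n, j) := by
    intro n
    induction n with
    | zero => simp
    | succ n ih =>
      have := h ((i + n + 1, j), true)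
      simp only [leftCell, rightCell, if_true, add_sub_cancel_right] at this
      rw [ih, this]
      push_cast
      rw [add_assoc]
  obtain ⟨N, hN⟩ := hW j
  rw [h1 (N - i).toNat]
  exact hN _ (by omega)

namespace AnnularDiagram

variable {D : AnnularDiagram}

/-! ## Joints of a smoothing -/

theorem flow_eq_zero_of_joined {u : D.State} {v : ℤ × ℤ} {d d' : Dir} (h : Joined u v d d') :
    (∃ b, d' = Dir.partner b d) ∨ ∀ d'', d'' ≠ d → d'' ≠ d' → D.flow (edgeAt v d'') = 0 := by
  obtain ⟨h1, h2, h3, h4⟩ := h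
  rcases D.local_form v with h | ⟨a, b, ha, hb, hab⟩ | ⟨h, -⟩
  · exfalso
    have := h d
    cases d <;> simp_all [Dir.sign]
  · right
    have key : ∀ x, D.flow (edgeAt v x) ≠ 0 → x = a ∨ x = b := by
      intro x hx
      by_contra! hc
      exact hx (hab x hc.1 hc.2)
    intro x hx hx'
    apply hab x <;> rintro rfl <;> rcases key d h1 with rfl | rfl <;>
      rcases key d' h2 with rfl | rfl <;> simp_all
  · exact Or.inl ⟨_, h4 h⟩

theorem joined_symm {u : D.State} {v : ℤ × ℤ} {d d' : Dir} (h : Joined u v d d') :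
    Joined u v d' d := by
  obtain ⟨h1, h2, h3, h4⟩ := h
  refine ⟨h2, h1, h3.symm, fun h => ?_⟩
  rw [h4 h]
  generalize (u ⟨v, h⟩ == D.horizontalOver v) = b
  cases b <;> cases d <;> rfl

theorem exists_joined (u : D.State) {v : ℤ × ℤ} {d : Dir} (hd : D.flow (edgeAt v d) ≠ 0) :
    ∃ d', Joined u v d d' := by
  rcases D.local_form v with h | ⟨a, b, ha, hb, hab⟩ | ⟨h, -⟩
  · exfalso
    have := h d
    cases d <;> simp_all [Dir.sign]
  · have hne : a ≠ b := by
      rintro rfl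
      rw [ha] at hb
      exact absurd hb (by decide)
    have hfa : D.flow (edgeAt v a) ≠ 0 := by
      intro h
      simp [h] at ha
    have hfb : D.flow (edgeAt v b) ≠ 0 := by
      intro h
      simp [h] at hb
    have hnc : ¬ ∀ d, D.flow (edgeAt v d) ≠ 0 := by
      intro h
      have : ∃ x, x ≠ a ∧ x ≠ b := by
        cases a <;> cases b <;> first | exact ⟨Dir.east, by decide⟩ | exact ⟨Dir.north, by decide⟩ |
          exact ⟨Dir.west, by decide⟩
      obtain ⟨x, hx⟩ := this
      exact h x (hab x hx.1 hx.2)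
    by_cases hda : d = a
    · exact ⟨b, hda ▸ hfa, hfb, hda ▸ hne, fun h => absurd h hnc⟩
    · by_cases hdb : d = b
      · exact ⟨a, hdb ▸ hfb, hfa, hdb ▸ hne.symm, fun h => absurd h hnc⟩
      · exact absurd (hab d hda hdb) hd
  · refine ⟨Dir.partner (u ⟨v, h⟩ == D.horizontalOver v) d, hd, h _, ?_, fun _ => rfl⟩
    generalize (u ⟨v, h⟩ == D.horizontalOver v) = b
    cases b <;> cases d <;> decide

theorem joined_unique {u : D.State} {v : ℤ × ℤ} {d d₁ d₂ : Dir} (h₁ : Joined u v d d₁)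
    (h₂ : Joined u v d d₂) : d₁ = d₂ := by
  by_cases h : ∀ d, D.flow (edgeAt v d) ≠ 0
  · rw [h₁.2.2.2 h, h₂.2.2.2 h]
  · rcases D.local_form v with h' | ⟨a, b, ha, hb, hab⟩ | ⟨h', -⟩
    · exfalso
      have := h' d
      have := h₁.1
      cases d <;> simp_all [Dir.sign]
    · have key : ∀ x, D.flow (edgeAt v x) ≠ 0 → x = a ∨ x = b := by
        intro x hx
        by_contra! hc
        exact hx (hab x hc.1 hc.2)
      have e1 := h₁.2.2.1
      have e2 := h₂.2.2.1
      rcases key d h₁.1 with rfl | rfl <;> rcases key d₁ h₁.2.1 with rfl | rfl <;>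
        rcases key d₂ h₂.2.1 with rfl | rfl <;> simp_all
    · exact absurd h' h

/-! ## The checkerboard orientation -/

variable (D) in
/-- The orientation of the link as an integral flow. -/
def linkFlow (e : GridEdge) : ℤ := (D.flow e : ℤ)

theorem linkFlow_support : (Function.support D.linkFlow).Finite := by
  refine D.finite_flow.subset fun e he => ?_
  simp only [Function.mem_support, linkFlow] at he ⊢
  intro h
  simp [h] at he

theorem linkFlow_divFree : DivFree D.linkFlow := by
  intro v
  unfold linkFlow
  rcases D.local_form v with h | ⟨a, b, ha, hb, hab⟩ | ⟨-, h1, h2⟩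
  · have h1 := h Dir.east
    have h2 := h Dir.north
    have h3 := h Dir.west
    have h4 := h Dir.south
    simp [Dir.sign] at h1 h2 h3 h4
    simp [h1, h2, h3, h4]
  · have ha' := congrArg (fun s : SignType => (s : ℤ)) ha
    have hb' := congrArg (fun s : SignType => (s : ℤ)) hb
    have hc := fun x h h' => congrArg (fun s : SignType => (s : ℤ)) (hab x h h')
    have h1 := hc Dir.east
    have h2 := hc Dir.north
    have h3 := hc Dir.west
    have h4 := hc Dir.south
    simp only [SignType.coe_mul] at ha' hb'
    cases a <;> cases b <;> simp [Dir.sign] at ha' hb' h1 h2 h3 h4 <;> linarith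
  · rw [h1, h2]

variable (D) in
/-- The winding number of the link around a cell. -/
def height (c : ℤ × ℤ) : ℤ := potential D.linkFlow c

theorem height_jump (v : ℤ × ℤ) (d : Dir) :
    D.height (ccwCell v d) - D.height (cwCell v d) = (d.sign : ℤ) * D.linkFlow (edgeAt v d) :=
  jump_around (potential_jump linkFlow_support linkFlow_divFree) v d

theorem linkFlow_odd {e : GridEdge} (h : D.flow e ≠ 0) : Odd (D.linkFlow e) := by
  unfold linkFlow
  generalize D.flow e = s at h
  cases s
  · exact absurd rfl h
  · exact ⟨-1, rfl⟩
  · exact ⟨0, rfl⟩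

theorem linkFlow_zero {e : GridEdge} (h : D.flow e = 0) : D.linkFlow e = 0 := by
  simp [linkFlow, h]

/-- The sign `1` for even numbers and `-1` for odd numbers. -/
def paritySign (n : ℤ) : SignType := if Even n then 1 else -1

theorem paritySign_ne_zero (n : ℤ) : paritySign n ≠ 0 := by
  unfold paritySign
  split_ifs <;> decide

theorem paritySign_neg {m n c : ℤ} (h : m - n = c) (hc : Odd c) :
    -paritySign n = paritySign m := by
  unfold paritySign
  have : Even m ↔ ¬ Even n := by
    rw [← Int.not_even_iff_odd, ← h, Int.even_sub] at hc
    tauto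
  by_cases hn : Even n
  · rw [if_pos hn, if_neg (by tauto)]
  · rw [if_neg hn, if_pos (by tauto)]
    rfl

variable (D) in
/-- The orientation of the edges with the cells of even height on the left. -/
def orient (e : GridEdge) : SignType := paritySign (D.height (leftCell e))

theorem orient_ne_zero (e : GridEdge) : D.orient e ≠ 0 := paritySign_ne_zero _

theorem sign_mul_orient {v : ℤ × ℤ} {d : Dir} (h : D.flow (edgeAt v d) ≠ 0) :
    d.sign * D.orient (edgeAt v d) = paritySign (D.height (ccwCell v d)) := by
  have h1 := height_jump (D := D) v d
  have h2 : Odd ((d.sign : ℤ) * D.linkFlow (edgeAt v d)) := by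
    refine Odd.mul ?_ (linkFlow_odd h)
    cases d <;> decide
  have h3 := paritySign_neg h1 h2
  cases d
  · exact one_mul _
  · exact one_mul _
  · rw [← h3]
    exact neg_one_mul _
  · rw [← h3]
    exact neg_one_mul _

theorem orient_joined {u : D.State} {v : ℤ × ℤ} {d d' : Dir} (h : Joined u v d d') :
    d.sign * D.orient (edgeAt v d) = -(d'.sign * D.orient (edgeAt v d')) := by
  rw [sign_mul_orient h.1, sign_mul_orient h.2.1]
  have key : Odd (D.height (ccwCell v d) - D.height (ccwCell v d')) := by
    have h1 := linkFlow_odd h.1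
    have h2 := linkFlow_odd h.2.1
    have he := height_jump (D := D) v Dir.east
    have hn := height_jump (D := D) v Dir.north
    have hw := height_jump (D := D) v Dir.west
    have hs := height_jump (D := D) v Dir.south
    rcases flow_eq_zero_of_joined h with ⟨b, rfl⟩ | h3
    · cases b <;> cases d <;> simp [ccwCell, cwCell, Dir.sign, Dir.partner] at * <;> grind
    · have h3' := fun x hx hx' => linkFlow_zero (h3 x hx hx')
      have hne := h.2.2.1
      have f1 := h3' Dir.east
      have f2 := h3' Dir.north
      have f3 := h3' Dir.west
      have f4 := h3' Dir.south
      clear h3 h3'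
      cases d <;> cases d' <;> simp [ccwCell, cwCell, Dir.sign] at * <;> grind
  exact (paritySign_neg rfl key).symm

variable (D) in
/-- The checkerboard orientation of the edges of the diagram. -/
def arcOrient (e : D.Arc) : SignType := D.orient e.1

theorem isCoherent_arcOrient {u : D.State} (C : Circle u) : IsCoherent C D.arcOrient := by
  refine ⟨fun e => orient_ne_zero _, fun e f v d d' h he hf _ => ?_⟩
  unfold arcOrient
  rw [he, hf]
  exact orient_joined h

end AnnularDiagram

theorem Dir.sign_ne_zero (d : Dir) : d.sign ≠ 0 := by
  cases d <;> decide

namespace AnnularDiagram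

variable {D : AnnularDiagram}

/-! ## Winding numbers of the circles of a smoothing -/

/-- The grid edge `e` lies on the circle `C`. -/
def OnCircle {u : D.State} (C : Circle u) (e : GridEdge) : Prop :=
  ∃ h : D.flow e ≠ 0, circleOf u ⟨e, h⟩ = C

theorem circleOf_eq_of_joined {u : D.State} {v : ℤ × ℤ} {d d' : Dir} (h : Joined u v d d') :
    circleOf u ⟨edgeAt v d, h.1⟩ = circleOf u ⟨edgeAt v d', h.2.1⟩ :=
  Quot.sound ⟨v, d, d', h, rfl, rfl⟩

theorem onCircle_joined {u : D.State} {v : ℤ × ℤ} {d d' : Dir} (h : Joined u v d d')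
    {C : Circle u} : OnCircle C (edgeAt v d) ↔ OnCircle C (edgeAt v d') := by
  constructor
  · rintro ⟨_, h2⟩
    exact ⟨h.2.1, (circleOf_eq_of_joined h).symm.trans h2⟩
  · rintro ⟨_, h2⟩
    exact ⟨h.1, (circleOf_eq_of_joined h).trans h2⟩

theorem circle_const {u : D.State} {C : Circle u} {T : Type*} (g : D.Arc → T)
    (hg : ∀ e f, ArcJoined u e f → circleOf u e = C → g e = g f) {e f : D.Arc}
    (he : circleOf u e = C) (hf : circleOf u f = C) : g e = g f := by
  classical
  have h1 : ∀ e f, ArcJoined u e f →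
      (if circleOf u e = C then some (g e) else none) =
        (if circleOf u f = C then some (g f) else none) := by
    intro e f hef
    have h2 : circleOf u e = circleOf u f := Quot.sound hef
    by_cases h : circleOf u e = C
    · rw [if_pos h, if_pos (h2 ▸ h), hg e f hef h]
    · rw [if_neg h, if_neg (h2 ▸ h)]
  have h3 := congrArg (Quot.lift _ h1) (he.trans hf.symm)
  change (if circleOf u e = C then some (g e) else none) =
        (if circleOf u f = C then some (g f) else none) at h3
  rw [if_pos he, if_pos hf] at h3
  exact Option.some.inj h3

open scoped Classical in
/-- A circle with its checkerboard orientation, as a flow. -/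
def circleFlow {u : D.State} (C : Circle u) (e : GridEdge) : ℤ :=
  if OnCircle C e then (D.orient e : ℤ) else 0

theorem circleFlow_support {u : D.State} (C : Circle u) :
    (Function.support (circleFlow C)).Finite := by
  refine D.finite_flow.subset fun e he => ?_
  simp only [Function.mem_support, circleFlow] at he ⊢
  intro h
  exact he (if_neg fun h' => h'.1 h)

theorem circleFlow_joined {u : D.State} (C : Circle u) {v : ℤ × ℤ} {d d' : Dir}
    (h : Joined u v d d') :
    (d.sign : ℤ) * circleFlow C (edgeAt v d) + d'.sign * circleFlow C (edgeAt v d') = 0 := by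
  unfold circleFlow
  by_cases hC : OnCircle C (edgeAt v d)
  · rw [if_pos hC, if_pos ((onCircle_joined h).1 hC), ← SignType.coe_mul, ← SignType.coe_mul,
      orient_joined h]
    generalize d'.sign * D.orient (edgeAt v d') = s
    cases s <;> rfl
  · rw [if_neg hC, if_neg (mt (onCircle_joined h).2 hC)]
    simp

theorem circleFlow_zero {u : D.State} (C : Circle u) {e : GridEdge} (h : D.flow e = 0) :
    circleFlow C e = 0 := if_neg fun h' => h'.1 h

theorem circleFlow_divFree {u : D.State} (C : Circle u) : DivFree (circleFlow C) := by
  intro v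
  have h0 := fun d => circleFlow_zero C (e := edgeAt v d)
  have hJ := fun d d' => circleFlow_joined C (v := v) (d := d) (d' := d')
  rcases D.local_form v with h | ⟨a, b, ha, hb, hab⟩ | ⟨h, -⟩
  · have h' : ∀ d, D.flow (edgeAt v d) = 0 := by
      intro d
      have := h d
      cases d <;> simpa [Dir.sign] using this
    simp only [h0 _ (h' _)]
  · have hfa : D.flow (edgeAt v a) ≠ 0 := by
      intro h
      simp [h] at ha
    obtain ⟨b', hb'⟩ := exists_joined u hfa
    have hbb : b' = b := by
      by_contra hne
      exact hb'.2.1 (hab b' hb'.2.2.1.symm hne)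
    subst hbb
    have h1 := hJ _ _ hb'
    have hne := hb'.2.2.1
    have h2 := fun d h h' => h0 d (hab d h h')
    have f1 := h2 Dir.east
    have f2 := h2 Dir.north
    have f3 := h2 Dir.west
    have f4 := h2 Dir.south
    clear h2 hab h0 hJ
    cases a <;> cases b' <;> simp [Dir.sign] at * <;> linarith
  · have hp : ∀ d, Joined u v d (Dir.partner (u ⟨v, h⟩ == D.horizontalOver v) d) := by
      intro d
      obtain ⟨d', hd'⟩ := exists_joined u (h d)
      rwa [← hd'.2.2.2 h]
    have h1 := hJ _ _ (hp Dir.east)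
    have h2 := hJ _ _ (hp Dir.west)
    generalize (u ⟨v, h⟩ == D.horizontalOver v) = b at h1 h2
    cases b <;> simp [Dir.partner, Dir.sign] at h1 h2 <;> linarith

/-- The winding number of a circle with its checkerboard orientation around a cell. -/
def circleWinding {u : D.State} (C : Circle u) (c : ℤ × ℤ) : ℤ := potential (circleFlow C) c

theorem circleWinding_jump {u : D.State} (C : Circle u) (e : GridEdge) :
    circleWinding C (leftCell e) - circleWinding C (rightCell e) = circleFlow C e :=
  potential_jump (circleFlow_support C) (circleFlow_divFree C) e

theorem circleWinding_vanishesEast {u : D.State} (C : Circle u) :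
    VanishesEast (circleWinding C) := potential_vanishesEast (circleFlow_support C)

theorem circleWinding_ccw_eq_cw {u : D.State} (C : Circle u) {v : ℤ × ℤ} {d d' : Dir}
    (h : Joined u v d d') :
    circleWinding C (ccwCell v d) = circleWinding C (cwCell v d') := by
  have hs := circleFlow_joined C h
  have hj := jump_around (circleWinding_jump C) v
  have he := hj Dir.east
  have hn := hj Dir.north
  have hw := hj Dir.west
  have hso := hj Dir.south
  rcases flow_eq_zero_of_joined h with ⟨b, rfl⟩ | h3
  · cases b <;> cases d <;> simp [ccwCell, cwCell, Dir.sign, Dir.partner] at * <;> linarith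
  · have h3' := fun x hx hx' => circleFlow_zero C (h3 x hx hx')
    have hne := h.2.2.1
    have f1 := h3' Dir.east
    have f2 := h3' Dir.north
    have f3 := h3' Dir.west
    have f4 := h3' Dir.south
    clear h3 h3' hj
    cases d <;> cases d' <;> simp [ccwCell, cwCell, Dir.sign] at * <;> linarith

theorem circleFlow_on {u : D.State} {C : Circle u} {e : GridEdge} (h : OnCircle C e) :
    circleFlow C e = D.orient e := if_pos h

theorem circleFlow_off {u : D.State} {C : Circle u} {e : GridEdge} (h : ¬ OnCircle C e) :
    circleFlow C e = 0 := if_neg h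

variable (D) in
/-- The cell on the left of an edge with its checkerboard orientation. -/
def evenCell (e : GridEdge) : ℤ × ℤ := if D.orient e = 1 then leftCell e else rightCell e

theorem orient_cases (e : GridEdge) : D.orient e = 1 ∨ D.orient e = -1 := by
  unfold orient paritySign
  split_ifs <;> simp

theorem evenCell_edgeAt (v : ℤ × ℤ) (d : Dir) :
    evenCell D (edgeAt v d) =
      if d.sign * D.orient (edgeAt v d) = 1 then ccwCell v d else cwCell v d := by
  unfold evenCell
  rcases orient_cases (D := D) (edgeAt v d) with h | h <;> rw [h] <;> cases d <;>
    simp [Dir.sign, edgeAt, leftCell, rightCell, ccwCell, cwCell]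

theorem circleWinding_evenCell_joined {u : D.State} (C : Circle u) {v : ℤ × ℤ} {d d' : Dir}
    (h : Joined u v d d') : circleWinding C (evenCell D (edgeAt v d)) =
      circleWinding C (evenCell D (edgeAt v d')) := by
  rw [evenCell_edgeAt, evenCell_edgeAt, orient_joined h]
  have h2 : d'.sign * D.orient (edgeAt v d') = 1 ∨ d'.sign * D.orient (edgeAt v d') = -1 := by
    rw [sign_mul_orient h.2.1]
    unfold paritySign
    split_ifs <;> simp
  rcases h2 with h2 | h2 <;> rw [h2]
  · rw [if_pos rfl, if_neg (by decide)]
    exact (circleWinding_ccw_eq_cw C (joined_symm h)).symm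
  · rw [if_pos (by decide), if_neg (by decide)]
    exact circleWinding_ccw_eq_cw C h

theorem circleWinding_evenCell_const {u : D.State} (C C' : Circle u) {e f : D.Arc}
    (he : circleOf u e = C) (hf : circleOf u f = C) :
    circleWinding C' (evenCell D e.1) = circleWinding C' (evenCell D f.1) := by
  refine circle_const (fun e : D.Arc => circleWinding C' (evenCell D e.1)) ?_ he hf
  rintro e f ⟨v, d, d', h, he, hf⟩ -
  simp only [he, hf]
  exact circleWinding_evenCell_joined C' h

/-- The winding numbers of a circle around the cells are `0` and one of `1` and `-1`. -/
theorem circleWinding_values {u : D.State} (C : Circle u) :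
    ∃ m : ℤ, (m = 1 ∨ m = -1) ∧ ∀ c, circleWinding C c = 0 ∨ circleWinding C c = m := by
  obtain ⟨e₀, he₀⟩ := Quot.exists_rep C
  set a := circleWinding C (evenCell D e₀.1) with ha
  have key : ∀ c, circleWinding C c ^ 2 - (2 * a - 1) * circleWinding C c = 0 := by
    apply eq_of_no_jump
    · intro j
      obtain ⟨N, hN⟩ := circleWinding_vanishesEast C j
      exact ⟨N, fun i hi => by simp [hN i hi]⟩
    · intro e
      have hj := circleWinding_jump C e
      by_cases h : OnCircle C e
      · rw [circleFlow_on h] at hj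
        obtain ⟨h1, h2⟩ := h
        have h3 := circleWinding_evenCell_const C C (e := e₀) (f := ⟨e, h1⟩) he₀ h2
        rw [← ha] at h3
        unfold evenCell at h3
        rcases orient_cases (D := D) e with ho | ho
        · rw [ho, if_pos rfl] at h3
          rw [ho, SignType.coe_one] at hj
          rw [show circleWinding C (rightCell e) = a - 1 by rw [h3]; linarith, ← h3]
          ring
        · rw [ho, if_neg (by decide)] at h3
          rw [ho, SignType.coe_neg_one] at hj
          rw [show circleWinding C (leftCell e) = a - 1 by rw [h3]; linarith, ← h3]
          ring
      · rw [circleFlow_off h, sub_eq_zero] at hj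
        rw [hj]
  have ha2 : a = 0 ∨ a = 1 := by
    have h1 := key (evenCell D e₀.1)
    rw [← ha] at h1
    have h2 : a * (a - 1) = 0 := by linarith
    rcases mul_eq_zero.1 h2 with h | h
    · exact Or.inl h
    · exact Or.inr (by linarith)
  refine ⟨2 * a - 1, by rcases ha2 with h | h <;> rw [h] <;> simp, fun c => ?_⟩
  have h1 := key c
  have h2 : circleWinding C c * (circleWinding C c - (2 * a - 1)) = 0 := by linarith
  rcases mul_eq_zero.1 h2 with h | h
  · exact Or.inl h
  · exact Or.inr (by linarith)

theorem circleWinding_sq {u : D.State} (C : Circle u) (c : ℤ × ℤ) :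
    circleWinding C c ^ 2 = 0 ∨ circleWinding C c ^ 2 = 1 := by
  obtain ⟨m, hm, h⟩ := circleWinding_values C
  rcases h c with h | h <;> rw [h]
  · simp
  · rcases hm with rfl | rfl <;> simp

theorem circleWinding_side {u : D.State} {C : Circle u} {e : GridEdge} (h : ¬ OnCircle C e) :
    circleWinding C (leftCell e) = circleWinding C (evenCell D e) ∧
      circleWinding C (rightCell e) = circleWinding C (evenCell D e) := by
  have hj := circleWinding_jump C e
  rw [circleFlow_off h, sub_eq_zero] at hj
  unfold evenCell
  split_ifs
  · exact ⟨rfl, hj.symm⟩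
  · exact ⟨hj, rfl⟩

/-- If a circle runs inside another circle then its interior is contained in the interior of the
other circle. -/
theorem circleWinding_nested {u : D.State} {C C' : Circle u} (hne : C ≠ C') {e : GridEdge}
    (he : OnCircle C e) (hin : circleWinding C' (leftCell e) ≠ 0) (c : ℤ × ℤ)
    (hc : circleWinding C c ≠ 0) : circleWinding C' c ≠ 0 := by
  have off : ∀ {A B : Circle u} {f : GridEdge}, A ≠ B → OnCircle A f → ¬ OnCircle B f := by
    rintro A B f h ⟨_, h1⟩ ⟨_, h2⟩
    exact h (h1.symm.trans h2)
  obtain ⟨h1, h2⟩ := he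
  have hin' : ∀ f, OnCircle C f → circleWinding C' (evenCell D f) ^ 2 = 1 := by
    rintro f ⟨h3, h4⟩
    rw [circleWinding_evenCell_const C C' (e := ⟨f, h3⟩) (f := ⟨e, h1⟩) h4 h2,
      ← (circleWinding_side (off hne ⟨h1, h2⟩)).1]
    exact (circleWinding_sq C' _).resolve_left (pow_ne_zero 2 hin)
  obtain ⟨e', he'⟩ := Quot.exists_rep C'
  set k := circleWinding C (evenCell D e'.1) with hk
  have key : ∀ c, circleWinding C c * (1 - circleWinding C' c ^ 2) +
      k * circleWinding C' c ^ 2 = 0 := by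
    apply eq_of_no_jump
    · intro j
      obtain ⟨N, hN⟩ := circleWinding_vanishesEast C j
      obtain ⟨N', hN'⟩ := circleWinding_vanishesEast C' j
      exact ⟨max N N', fun i hi => by
        simp [hN i (le_trans (le_max_left _ _) hi), hN' i (le_trans (le_max_right _ _) hi)]⟩
    · intro f
      by_cases hC : OnCircle C f
      · obtain ⟨h3, h4⟩ := circleWinding_side (off hne hC)
        rw [h3, h4, hin' f hC]
        ring
      · obtain ⟨h3, h4⟩ := circleWinding_side hC
        by_cases hC' : OnCircle C' f
        · obtain ⟨h5, h6⟩ := hC'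
          rw [h3, h4, ← circleWinding_evenCell_const C' C (e := e') (f := ⟨f, h5⟩) he' h6]
          ring
        · obtain ⟨h5, h6⟩ := circleWinding_side hC'
          rw [h3, h4, h5, h6]
  intro h
  have := key c
  rw [h] at this
  simp at this
  exact hc this

/-! ## The essential circles along the ray from the puncture -/

theorem tsum_ray {F : GridEdge → ℤ} (hF : ∀ e, D.flow e = 0 → F e = 0) [DecidablePred fun
    e : GridEdge => ∃ n, e = rayEdge n] :
    ∑' n, F (rayEdge n) = ∑ e : D.Arc, if ∃ n, e.1 = rayEdge n then F e.1 else 0 := by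
  have h1 : Function.Injective rayEdge := by
    intro m n h
    simpa [rayEdge] using h
  have h2 : Function.Injective (fun e : D.Arc => e.1) := Subtype.val_injective
  let F' : GridEdge → ℤ := fun e => if ∃ n, e = rayEdge n then F e else 0
  have h3 : ∑' n, F' (rayEdge n) = ∑' e, F' e := h1.tsum_eq (by
    intro e he
    by_contra hc
    exact he (if_neg fun ⟨n, hn⟩ => hc ⟨n, hn.symm⟩))
  have h4 : ∑' e : D.Arc, F' e.1 = ∑' e, F' e := h2.tsum_eq (f := F') (by
    intro e he
    have : D.flow e ≠ 0 := by
      intro h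
      apply he
      simp only [F', hF e h, ite_self]
    exact ⟨⟨e, this⟩, rfl⟩)
  rw [tsum_fintype] at h4
  rw [h4, ← h3]
  exact tsum_congr fun n => (if_pos ⟨n, rfl⟩).symm

theorem winding_eq_circleWinding {u : D.State} (C : Circle u) :
    winding C D.arcOrient = circleWinding C (0, 0) := by
  classical
  have h := tsum_ray (D := D) (F := circleFlow C) fun e he => circleFlow_zero C he
  have h2 : circleWinding C (0, 0) = ∑' n, circleFlow C (rayEdge n) :=
    tsum_congr fun n => by
      simp only [rayEdge, zero_add, add_comm]
  rw [h2, h]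
  unfold winding
  refine Finset.sum_congr rfl fun e _ => ?_
  have h3 : OnCircle C e.1 ↔ circleOf u e = C :=
    ⟨fun h => h.2, fun h => ⟨e.2, h⟩⟩
  unfold circleFlow arcOrient
  by_cases h4 : circleOf u e = C <;> by_cases h5 : ∃ n, e.1 = rayEdge n <;> simp [h3, h4, h5]

theorem isEssential_iff {u : D.State} (C : Circle u) :
    IsEssential C ↔ circleWinding C (0, 0) ≠ 0 := by
  classical
  rw [← winding_eq_circleWinding]
  constructor
  · rintro ⟨o, ho, hw⟩ h
    obtain ⟨e₀, he₀⟩ := Quot.exists_rep C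
    have h1 : ∀ e, circleOf u e = C → o e * D.arcOrient e = o e₀ * D.arcOrient e₀ := by
      intro e he
      refine circle_const (fun e => o e * D.arcOrient e) ?_ he he₀
      rintro e f ⟨v, d, d', hj, he, hf⟩ hC
      have h2 := ho.2 e f v d d' hj he hf hC
      have h3 := (isCoherent_arcOrient C).2 e f v d d' hj he hf hC
      generalize o e = a at *
      generalize o f = b at *
      generalize D.arcOrient e = a' at *
      generalize D.arcOrient f = b' at *
      have hx' := d.sign_ne_zero
      have hy' := d'.sign_ne_zero
      generalize d.sign = x at *
      generalize d'.sign = y at *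
      clear * - h2 h3 hx' hy'
      revert a b a' b' x y
      decide
    apply hw
    have h2 : winding C o = ((o e₀ * D.arcOrient e₀ : SignType) : ℤ) * winding C D.arcOrient := by
      unfold winding
      rw [Finset.mul_sum]
      refine Finset.sum_congr rfl fun e _ => ?_
      by_cases h4 : circleOf u e = C ∧ ∃ n, e.1 = rayEdge n
      · rw [if_pos h4, if_pos h4, ← h1 e h4.1, ← SignType.coe_mul, mul_assoc]
        have := (isCoherent_arcOrient C).1 e
        congr 1
        generalize D.arcOrient e = x at this
        generalize o e = y
        revert x y
        decide
      · rw [if_neg h4, if_neg h4, mul_zero]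
    rw [h2, h, mul_zero]
  · exact fun h => ⟨_, isCoherent_arcOrient C, h⟩

theorem circleWinding_ray {u : D.State} (C : Circle u) (n : ℕ) :
    circleWinding C (n, 0) - circleWinding C (n + 1, 0) = circleFlow C (rayEdge n) := by
  have h := circleWinding_jump C (rayEdge n)
  simpa [leftCell, rightCell, rayEdge] using h

theorem circleWinding_before {u : D.State} (C : Circle u) {n : ℕ} (hn : n ≤ firstHit C) :
    circleWinding C (n, 0) = circleWinding C (0, 0) := by
  induction n with
  | zero => rfl
  | succ n ih =>
    have h := circleWinding_ray C n
    rw [circleFlow_off, sub_eq_zero] at h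
    · rw [← ih (by omega), h]
      push_cast
      rfl
    · rintro ⟨h1, h2⟩
      exact Nat.notMem_of_lt_sInf (lt_of_lt_of_le n.lt_succ_self hn) ⟨⟨_, h1⟩, rfl, h2⟩

theorem onCircle_firstHit {u : D.State} {C : Circle u} (h : IsEssential C) :
    OnCircle C (rayEdge (firstHit C)) := by
  rw [isEssential_iff] at h
  have hne : {n : ℕ | ∃ e : D.Arc, e.1 = rayEdge n ∧ circleOf u e = C}.Nonempty := by
    by_contra hc
    have h1 : ∀ n : ℕ, circleWinding C (n, 0) = circleWinding C (0, 0) := by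
      intro n
      induction n with
      | zero => rfl
      | succ n ih =>
        have h := circleWinding_ray C n
        rw [circleFlow_off, sub_eq_zero] at h
        · rw [← ih, h]
          push_cast
          rfl
        · rintro ⟨h1, h2⟩
          exact hc ⟨n, ⟨_, h1⟩, rfl, h2⟩
    obtain ⟨N, hN⟩ := circleWinding_vanishesEast C 0
    exact h ((h1 N.toNat).symm.trans (hN _ (by omega)))
  obtain ⟨e, he, hC⟩ := Nat.sInf_mem hne
  have h2 := e.2
  obtain ⟨e, h3⟩ := e
  subst he
  exact ⟨h2, hC⟩

theorem circleWinding_after {u : D.State} {C : Circle u} (h : IsEssential C) :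
    circleWinding C (firstHit C + 1, 0) = 0 := by
  have h1 := circleWinding_ray C (firstHit C)
  rw [circleFlow_on (onCircle_firstHit h), circleWinding_before C le_rfl] at h1
  rw [isEssential_iff] at h
  obtain ⟨m, hm, hv⟩ := circleWinding_values C
  rw [(hv _).resolve_left h] at h1
  refine (hv _).resolve_right fun h2 => ?_
  rw [h2, sub_self] at h1
  rcases orient_cases (D := D) (rayEdge (firstHit C)) with ho | ho <;> rw [ho] at h1 <;>
    simp at h1

theorem circleWinding_eq_orient {u : D.State} {C : Circle u} (h : IsEssential C) :
    circleWinding C (0, 0) = D.orient (rayEdge (firstHit C)) := by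
  have h1 := circleWinding_ray C (firstHit C)
  rw [circleFlow_on (onCircle_firstHit h), circleWinding_before C le_rfl,
    circleWinding_after h, sub_zero] at h1
  exact h1

theorem height_parity (u : D.State) (n : ℕ) :
    Even (D.height (n, 0) - D.height (0, 0) -
      ∑ C : Circle u, (circleWinding C (n, 0) - circleWinding C (0, 0))) := by
  induction n with
  | zero => simp
  | succ n ih =>
    have h1 : D.height (n, 0) - D.height (n + 1, 0) = D.linkFlow (rayEdge n) := by
      have h := potential_jump (linkFlow_support (D := D)) linkFlow_divFree (rayEdge n)
      simp only [leftCell, rightCell, rayEdge, if_true, add_sub_cancel_right] at h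
      exact h
    have h2 : Even (D.linkFlow (rayEdge n) - ∑ C : Circle u, circleFlow C (rayEdge n)) := by
      by_cases hf : D.flow (rayEdge n) = 0
      · rw [linkFlow_zero hf, Finset.sum_eq_zero fun C _ => circleFlow_zero C hf]
        simp
      · have h3 : ∀ C : Circle u, circleFlow C (rayEdge n) =
            if circleOf u ⟨_, hf⟩ = C then (D.orient (rayEdge n) : ℤ) else 0 := by
          intro C
          by_cases hC : circleOf u ⟨_, hf⟩ = C
          · rw [if_pos hC, circleFlow_on ⟨hf, hC⟩]
          · rw [if_neg hC, circleFlow_off fun ⟨_, h⟩ => hC h]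
        rw [Finset.sum_congr rfl fun C _ => h3 C, Finset.sum_ite_eq, if_pos (Finset.mem_univ _)]
        refine (linkFlow_odd hf).sub_odd ?_
        rcases orient_cases (D := D) (rayEdge n) with ho | ho <;> rw [ho] <;> decide
    have h3 : ∑ C : Circle u, (circleWinding C (((n + 1 : ℕ) : ℤ), 0) - circleWinding C (0, 0)) =
        ∑ C : Circle u, (circleWinding C (n, 0) - circleWinding C (0, 0)) -
          ∑ C : Circle u, circleFlow C (rayEdge n) := by
      rw [← Finset.sum_sub_distrib]
      refine Finset.sum_congr rfl fun C _ => ?_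
      rw [← circleWinding_ray]
      push_cast
      ring
    rw [h3]
    push_cast
    have h4 := ih.sub h2
    rw [← h1] at h4
    have h5 : ∀ a b c S F : ℤ, a - b - S - (a - c - F) = c - b - (S - F) := by
      intros
      ring
    rwa [h5] at h4

theorem odd_crossings {u : D.State} {C : Circle u} (h : IsEssential C) (C' : Circle u) :
    Odd (circleWinding C' (firstHit C, 0) - circleWinding C' (0, 0)) ↔
      IsEssential C' ∧ firstHit C' < firstHit C := by
  have hodd : IsEssential C' → Odd (0 - circleWinding C' (0, 0)) := by
    intro h'
    rw [circleWinding_eq_orient h']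
    rcases orient_cases (D := D) (rayEdge (firstHit C')) with ho | ho <;> rw [ho] <;> decide
  have hC := onCircle_firstHit h
  have hl : leftCell (rayEdge (firstHit C)) = ((firstHit C : ℤ), 0) := by
    simp [leftCell, rayEdge]
  have h00 := (isEssential_iff C).1 h
  constructor
  · intro hO
    have hne : C ≠ C' := by
      rintro rfl
      rw [circleWinding_before C le_rfl, sub_self] at hO
      exact absurd hO (by decide)
    have hlt : firstHit C' < firstHit C := by
      by_contra hle
      rw [circleWinding_before C' (not_lt.1 hle), sub_self] at hO
      exact absurd hO (by decide)
    refine ⟨?_, hlt⟩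
    rw [isEssential_iff]
    intro hc
    rw [hc, sub_zero] at hO
    refine circleWinding_nested hne hC ?_ _ h00 hc
    rw [hl]
    intro h0
    rw [h0] at hO
    exact absurd hO (by decide)
  · rintro ⟨h', hlt⟩
    have hne : C ≠ C' := by
      rintro rfl
      exact lt_irrefl _ hlt
    have h1 : circleWinding C' (firstHit C, 0) = 0 := by
      by_contra hc
      refine circleWinding_nested hne hC (hl ▸ hc) _ ?_ (circleWinding_after h')
      have h2 := circleWinding_before C (n := firstHit C' + 1) hlt
      push_cast at h2
      rwa [h2]
    rw [h1]
    exact hodd h'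

/-- The winding number of an essential circle with its checkerboard orientation is determined by
the parity of its number. -/
theorem circleWinding_of_isEssential {u : D.State} {C : Circle u} (h : IsEssential C) :
    circleWinding C (0, 0) = if Odd (essentialIndex C) then (paritySign (D.height (0, 0)) : ℤ)
      else -(paritySign (D.height (0, 0)) : ℤ) := by
  classical
  have h1 := height_parity u (firstHit C)
  have h2 : Even (∑ C' : Circle u,
      (circleWinding C' (firstHit C, 0) - circleWinding C' (0, 0)) -
        Nat.card {C' : Circle u // IsEssential C' ∧ firstHit C' < firstHit C}) := by
    rw [Nat.card_eq_fintype_card, Fintype.card_subtype, Finset.card_filter, Nat.cast_sum,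
      ← Finset.sum_sub_distrib]
    refine Finset.even_sum _ fun C' _ => ?_
    have h3 := odd_crossings h C'
    by_cases h4 : IsEssential C' ∧ firstHit C' < firstHit C
    · rw [if_pos h4]
      exact (h3.2 h4).sub_odd (by decide)
    · rw [if_neg h4]
      rw [Nat.cast_zero, sub_zero, ← Int.not_odd_iff_even]
      exact fun h5 => h4 (h3.1 h5)
  have h3 := h1.add h2
  have h4 : D.orient (rayEdge (firstHit C)) = paritySign (D.height (firstHit C, 0)) := by
    simp [orient, leftCell, rayEdge]
  rw [circleWinding_eq_orient h, h4]
  unfold essentialIndex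
  set k := Nat.card {C' : Circle u // IsEssential C' ∧ firstHit C' < firstHit C} with hk
  by_cases hev : Even k
  · rw [if_pos (by rw [add_comm]; exact hev.add_one)]
    unfold paritySign
    have hz : Even (k : ℤ) := by exact_mod_cast hev
    congr 1
    have : Even (D.height (firstHit C, 0)) ↔ Even (D.height (0, 0)) := by grind
    simp only [this]
  · rw [Nat.not_even_iff_odd] at hev
    have hz : Odd (k : ℤ) := by exact_mod_cast hev
    rw [if_neg (by rw [Nat.not_odd_iff_even, add_comm]; exact hev.add_one)]
    rw [← paritySign_neg (m := D.height (firstHit C, 0)) (n := D.height (0, 0)) rfl (by grind)]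
    generalize paritySign (D.height (0, 0)) = s
    cases s <;> rfl

end AnnularDiagram

/-! ## Permutations and transpositions -/

theorem Equiv.Perm.sameCycle_mul_swap_of_not_sameCycle {β : Type*} [Finite β] [DecidableEq β]
    {σ : Equiv.Perm β} {a b : β} (h : ¬ σ.SameCycle a b) :
    (σ * Equiv.swap a b).SameCycle a b := by
  have hp := (isOfFinOrder_of_finite σ).orderOf_pos
  have hex : ∃ n, 0 < n ∧ (σ ^ n) a = a := ⟨orderOf σ, hp, by simp [pow_orderOf_eq_one]⟩
  classical
  obtain ⟨hn, hna⟩ := Nat.find_spec hex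
  have hmin := fun m => Nat.find_min hex (m := m)
  set n := Nat.find hex
  have key : ∀ k, k < n → ((σ * Equiv.swap a b) ^ (k + 1)) b = (σ ^ (k + 1)) a := by
    intro k
    induction k with
    | zero => simp
    | succ k ih =>
      intro hk
      rw [pow_succ', Equiv.Perm.mul_apply, ih (by omega), Equiv.Perm.mul_apply,
        Equiv.swap_apply_of_ne_of_ne, ← Equiv.Perm.mul_apply, ← pow_succ']
      · exact fun h' => hmin (k + 1) hk ⟨by omega, h'⟩
      · exact fun h' => h ⟨(k + 1 : ℕ), by rw [zpow_natCast]; exact h'⟩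
  have h2 := key (n - 1) (by omega)
  rw [Nat.sub_add_cancel hn, hna] at h2
  exact Equiv.Perm.SameCycle.symm ⟨n, by rw [zpow_natCast]; exact h2⟩

theorem Equiv.Perm.not_sameCycle_mul_swap_of_sameCycle {β : Type*} [Finite β] [DecidableEq β]
    {σ : Equiv.Perm β} {a b : β} (hab : a ≠ b) (h : σ.SameCycle a b) :
    ¬ (σ * Equiv.swap a b).SameCycle a b := by
  classical
  obtain ⟨n', hn'⟩ := h.exists_nat_pow_eq
  have hex : ∃ n, (σ ^ n) a = b := ⟨n', hn'⟩
  have hnb := Nat.find_spec hex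
  have hmin := fun m => Nat.find_min hex (m := m)
  set n := Nat.find hex
  have hn : 0 < n := by
    rw [pos_iff_ne_zero]
    intro h0
    rw [h0] at hnb
    exact hab hnb
  have hne : ∀ k, 0 < k → k ≤ n → (σ ^ k) a ≠ a := by
    intro k hk hkn h'
    refine hmin (n - k) (by omega) ?_
    have : (σ ^ n) a = (σ ^ (n - k)) ((σ ^ k) a) := by
      rw [← Equiv.Perm.mul_apply, ← pow_add, Nat.sub_add_cancel hkn]
    rw [h'] at this
    rw [← this, hnb]
  have key : ∀ j : ℕ, ∃ k, 0 < k ∧ k ≤ n ∧ ((σ * Equiv.swap a b) ^ j) b = (σ ^ k) a := by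
    intro j
    induction j with
    | zero => exact ⟨n, hn, le_rfl, hnb.symm⟩
    | succ j ih =>
      obtain ⟨k, hk, hkn, h'⟩ := ih
      rw [pow_succ', Equiv.Perm.mul_apply, h', Equiv.Perm.mul_apply]
      rcases hkn.lt_or_eq with hlt | rfl
      · refine ⟨k + 1, by omega, by omega, ?_⟩
        rw [Equiv.swap_apply_of_ne_of_ne (hne k hk hkn) (hmin k hlt), pow_succ',
          Equiv.Perm.mul_apply]
      · refine ⟨1, one_pos, hn, ?_⟩
        rw [hnb, Equiv.swap_apply_right, pow_one]
  intro h'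
  obtain ⟨j, hj⟩ := h'.symm.exists_nat_pow_eq
  obtain ⟨k, hk, hkn, h2⟩ := key j
  exact hne k hk hkn (h2.symm.trans hj)

/-! ## The circles before and after a saddle -/

theorem edgeAt_injective {v v' : ℤ × ℤ} {d d' : Dir} (h : edgeAt v d = edgeAt v' d')
    (hs : d.sign = d'.sign) : v = v' ∧ d = d' := by
  obtain ⟨x, y⟩ := v
  obtain ⟨x', y'⟩ := v'
  cases d <;> cases d' <;> simp [edgeAt, Dir.sign] at h hs ⊢ <;> exact h

theorem exists_edgeAt (e : GridEdge) {s : SignType} (hs : s ≠ 0) :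
    ∃ v d, e = edgeAt v d ∧ d.sign = s := by
  obtain ⟨⟨x, y⟩, b⟩ := e
  cases b <;> cases s
  · exact absurd rfl hs
  · exact ⟨(x + 1, y), Dir.west, by simp [edgeAt], rfl⟩
  · exact ⟨(x, y), Dir.east, rfl, rfl⟩
  · exact absurd rfl hs
  · exact ⟨(x, y + 1), Dir.south, by simp [edgeAt], rfl⟩
  · exact ⟨(x, y), Dir.north, rfl, rfl⟩

namespace AnnularDiagram

variable {D : AnnularDiagram}

/-- The edge `f` follows the edge `e` on a circle with its checkerboard orientation. -/
def Follows (u : D.State) (e f : D.Arc) : Prop :=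
  ∃ v d d', Joined u v d d' ∧ e.1 = edgeAt v d ∧ f.1 = edgeAt v d' ∧
    d.sign * D.orient (edgeAt v d) = -1

theorem sign_mul_eq {a b s : SignType} (h : a * s = -1) (h' : b * s = -1) : a = b := by
  revert a b s
  decide

theorem exists_follows (u : D.State) (e : D.Arc) : ∃ f, Follows u e f := by
  obtain ⟨v, d, h, hs⟩ := exists_edgeAt e.1 (s := -D.orient e.1)
    (by have := orient_ne_zero (D := D) e.1; revert this; generalize D.orient e.1 = s
        revert s; decide)
  obtain ⟨d', hd'⟩ := exists_joined u (h ▸ e.2)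
  refine ⟨⟨_, hd'.2.1⟩, v, d, d', hd', h, rfl, ?_⟩
  rw [← h, hs]
  rcases orient_cases (D := D) e.1 with ho | ho <;> rw [ho] <;> decide

theorem Follows.right_unique {u : D.State} {e f f' : D.Arc} (h : Follows u e f)
    (h' : Follows u e f') : f = f' := by
  obtain ⟨v, d, a, hj, he, hf, hs⟩ := h
  obtain ⟨v', d', a', hj', he', hf', hs'⟩ := h'
  rw [← he] at hs
  rw [← he'] at hs'
  obtain ⟨rfl, rfl⟩ := edgeAt_injective (he.symm.trans he') (sign_mul_eq hs hs')
  rw [joined_unique hj hj', ← hf'] at hf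
  exact Subtype.ext hf

theorem Follows.left_unique {u : D.State} {e e' f : D.Arc} (h : Follows u e f)
    (h' : Follows u e' f) : e = e' := by
  obtain ⟨v, d, a, hj, he, hf, hs⟩ := h
  obtain ⟨v', d', a', hj', he', hf', hs'⟩ := h'
  have key : ∀ {x y : SignType}, x = -1 → x = -y → y = 1 := by decide
  have h1 := key hs (orient_joined hj)
  have h2 := key hs' (orient_joined hj')
  rw [← hf] at h1
  rw [← hf'] at h2
  have h3 : a.sign = a'.sign := by
    generalize a.sign = x at *
    generalize a'.sign = y at *
    generalize D.orient f.1 = z at *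
    clear * - h1 h2
    revert x y z
    decide
  obtain ⟨rfl, rfl⟩ := edgeAt_injective (hf.symm.trans hf') h3
  rw [joined_unique (joined_symm hj) (joined_symm hj'), ← he'] at he
  exact Subtype.ext he

/-- The permutation of the edges that moves each edge on by one step along its circle. -/
def nextPerm (u : D.State) : Equiv.Perm D.Arc :=
  Equiv.ofBijective (fun e => (exists_follows u e).choose) <|
    Finite.injective_iff_bijective.1 fun e e' h =>
      ((exists_follows u e).choose_spec).left_unique
        ((congrArg (Follows u e') h).mpr (exists_follows u e').choose_spec)

theorem follows_iff {u : D.State} {e f : D.Arc} : Follows u e f ↔ nextPerm u e = f := by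
  have h : Follows u e (nextPerm u e) := (exists_follows u e).choose_spec
  exact ⟨fun h' => h.right_unique h', fun h' => h' ▸ h⟩

theorem circleOf_eq_iff_eqvGen {u : D.State} {e f : D.Arc} :
    circleOf u e = circleOf u f ↔ Relation.EqvGen (ArcJoined u) e f := Quot.eq

theorem circleOf_eq_iff_sameCycle {u : D.State} {e f : D.Arc} :
    circleOf u e = circleOf u f ↔ (nextPerm u).SameCycle e f := by
  constructor
  · intro h
    rw [circleOf_eq_iff_eqvGen] at h
    induction h with
    | rel e f h =>
      obtain ⟨v, d, d', hj, he, hf⟩ := h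
      have h1 : d.sign * D.orient (edgeAt v d) = -1 ∨ d'.sign * D.orient (edgeAt v d') = -1 := by
        have h2 := orient_joined hj
        rw [sign_mul_orient hj.1] at *
        have h3 := paritySign_ne_zero (D.height (ccwCell v d))
        revert h2 h3
        generalize paritySign (D.height (ccwCell v d)) = s
        generalize d'.sign * D.orient (edgeAt v d') = t
        revert s t
        decide
      rcases h1 with h1 | h1
      · exact ⟨1, by simpa using follows_iff.1 ⟨v, d, d', hj, he, hf, h1⟩⟩
      · exact Equiv.Perm.SameCycle.symm
          ⟨1, by simpa using follows_iff.1 ⟨v, d', d, joined_symm hj, hf, he, h1⟩⟩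
    | refl e => exact Equiv.Perm.SameCycle.refl _ _
    | symm e f _ ih => exact ih.symm
    | trans e f g _ _ ih1 ih2 => exact ih1.trans ih2
  · intro h
    obtain ⟨n, rfl⟩ := h.exists_nat_pow_eq
    clear h
    induction n with
    | zero => rfl
    | succ n ih =>
      rw [ih, pow_succ', Equiv.Perm.mul_apply]
      obtain ⟨v, d, d', hj, he, hf, -⟩ := follows_iff.2 (rfl : nextPerm u (((nextPerm u) ^ n) e) = _)
      exact Quot.sound ⟨v, d, d', hj, he, hf⟩

theorem joined_crossing (u : D.State) (p : D.Crossing) (d : Dir) :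
    Joined u p.1 d (Dir.partner (u p == D.horizontalOver p.1) d) := by
  obtain ⟨d', hd'⟩ := exists_joined u (p.2 d)
  have := hd'.2.2.2 p.2
  rwa [← show d' = Dir.partner (u p == D.horizontalOver p.1) d from this]

theorem joined_congr {u v : D.State} {w : ℤ × ℤ} {d d' : Dir}
    (h : ∀ h, u ⟨w, h⟩ = v ⟨w, h⟩) (hj : Joined u w d d') : Joined v w d d' :=
  ⟨hj.1, hj.2.1, hj.2.2.1, fun h' => h h' ▸ hj.2.2.2 h'⟩

theorem follows_off {u v : D.State} {p : D.Crossing} (huv : ∀ q, q ≠ p → u q = v q)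
    {e f : D.Arc} (h : Follows u e f)
    (he : ∀ d, e = D.arcAt p d → d.sign * D.orient (edgeAt p.1 d) ≠ -1) : Follows v e f := by
  obtain ⟨w, d, d', hj, h1, h2, hs⟩ := h
  refine ⟨w, d, d', joined_congr (fun h' => huv _ ?_) hj, h1, h2, hs⟩
  rintro rfl
  exact he d (Subtype.ext h1) hs

theorem follows_crossing (u : D.State) (p : D.Crossing) {d : Dir}
    (hd : d.sign * D.orient (edgeAt p.1 d) = -1) :
    Follows u (D.arcAt p d) (D.arcAt p (Dir.partner (u p == D.horizontalOver p.1) d)) :=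
  ⟨p.1, d, _, joined_crossing u p d, rfl, rfl, hd⟩

/-- The opposite direction. -/
def _root_.Dir.opp : Dir → Dir
  | Dir.east => Dir.west
  | Dir.west => Dir.east
  | Dir.north => Dir.south
  | Dir.south => Dir.north

theorem partner_not (b : Bool) (d : Dir) : Dir.partner (!b) d = Dir.partner b d.opp := by
  cases b <;> cases d <;> rfl

theorem arcAt_injective (p : D.Crossing) : Function.Injective (D.arcAt p) := by
  intro d d' h
  have h1 := congrArg Subtype.val h
  obtain ⟨⟨x, y⟩, hp⟩ := p
  cases d <;> cases d' <;> simp [arcAt, edgeAt] at h1 ⊢ <;> omega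

theorem orient_opp (p : D.Crossing) (d : Dir) :
    d.opp.sign * D.orient (edgeAt p.1 d.opp) = d.sign * D.orient (edgeAt p.1 d) := by
  have h1 := orient_joined (joined_crossing (fun _ => false) p d)
  have h2 := orient_joined (joined_crossing (fun _ => true) p d.opp)
  have h3 : ∀ b : Bool, Dir.partner (true == b) d.opp = Dir.partner (false == b) d := by
    intro b
    cases b <;> cases d <;> rfl
  rw [h3] at h2
  rw [h1, h2]

theorem nextPerm_flip {u v : D.State} {p : D.Crossing} (huv : ∀ q, q ≠ p → u q = v q)
    (hp : v p = !u p) [DecidableEq D.Arc] {d : Dir}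
    (hd : d.sign * D.orient (edgeAt p.1 d) = -1) :
    nextPerm v = nextPerm u * Equiv.swap (D.arcAt p d) (D.arcAt p d.opp) := by
  have hd' : d.opp.sign * D.orient (edgeAt p.1 d.opp) = -1 := (orient_opp p d).trans hd
  have hb : (v p == D.horizontalOver p.1) = !(u p == D.horizontalOver p.1) := by
    rw [hp]
    generalize u p = x
    generalize D.horizontalOver p.1 = y
    revert x y
    decide
  have hoo : d.opp.opp = d := by cases d <;> rfl
  ext1 e
  rw [Equiv.Perm.mul_apply, ← follows_iff]
  by_cases h1 : e = D.arcAt p d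
  · rw [h1, Equiv.swap_apply_left, follows_iff.1 (follows_crossing u p hd'), ← partner_not, ← hb]
    exact follows_crossing v p hd
  · by_cases h2 : e = D.arcAt p d.opp
    · rw [h2, Equiv.swap_apply_right, follows_iff.1 (follows_crossing u p hd)]
      have := follows_crossing v p hd'
      rwa [hb, partner_not, hoo] at this
    · rw [Equiv.swap_apply_of_ne_of_ne h1 h2]
      refine follows_off huv (follows_iff.2 rfl) ?_
      rintro a rfl ha
      have h5 : a ≠ d := fun h => h1 (h ▸ rfl)
      have h6 : a ≠ d.opp := fun h => h2 (h ▸ rfl)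
      have h7 : ∃ b, a = Dir.partner b d := by
        cases a <;> cases d <;> first | exact ⟨true, rfl⟩ | exact ⟨false, rfl⟩ | simp [Dir.opp] at h5 h6
      obtain ⟨b, rfl⟩ := h7
      have h8 := orient_joined
        (joined_crossing (fun _ => (b == D.horizontalOver p.1)) p d)
      rw [show ((b == D.horizontalOver p.1) == D.horizontalOver p.1) = b by
        cases b <;> cases D.horizontalOver p.1 <;> rfl] at h8
      rw [hd, ha] at h8
      exact absurd h8 (by decide)

theorem circleOf_arcAt (u : D.State) (p : D.Crossing) (d : Dir) :
    circleOf u (D.arcAt p d) =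
      circleOf u (D.arcAt p (Dir.partner (u p == D.horizontalOver p.1) d)) :=
  circleOf_eq_of_joined (joined_crossing u p d)

theorem circleOf_north_eq_south_iff (u : D.State) (p : D.Crossing) :
    circleOf u (D.arcAt p Dir.north) = circleOf u (D.arcAt p Dir.south) ↔
      circleOf u (D.arcAt p Dir.east) = circleOf u (D.arcAt p Dir.west) := by
  rw [circleOf_arcAt u p Dir.east, circleOf_arcAt u p Dir.west]
  generalize (u p == D.horizontalOver p.1) = b
  cases b
  · exact eq_comm
  · exact Iff.rfl

/-- A saddle merges two circles or splits a circle. -/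
theorem circleOf_flip {u v : D.State} {p : D.Crossing} (huv : ∀ q, q ≠ p → u q = v q)
    (hp : v p = !u p) :
    circleOf v (D.arcAt p Dir.east) = circleOf v (D.arcAt p Dir.west) ↔
      circleOf u (D.arcAt p Dir.east) ≠ circleOf u (D.arcAt p Dir.west) := by
  classical
  have key : ∀ d, d.sign * D.orient (edgeAt p.1 d) = -1 →
      (circleOf v (D.arcAt p d) = circleOf v (D.arcAt p d.opp) ↔
        circleOf u (D.arcAt p d) ≠ circleOf u (D.arcAt p d.opp)) := by
    intro d hd
    rw [circleOf_eq_iff_sameCycle, Ne, circleOf_eq_iff_sameCycle, nextPerm_flip huv hp hd]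
    constructor
    · intro h1 h2
      refine Equiv.Perm.not_sameCycle_mul_swap_of_sameCycle ?_ h2 h1
      intro h
      have := arcAt_injective p h
      cases d <;> simp [Dir.opp] at this
    · exact Equiv.Perm.sameCycle_mul_swap_of_not_sameCycle
  have h1 : Dir.east.sign * D.orient (edgeAt p.1 Dir.east) = -1 ∨
      Dir.north.sign * D.orient (edgeAt p.1 Dir.north) = -1 := by
    have h2 := orient_joined (joined_crossing (fun _ => D.horizontalOver p.1) p Dir.east)
    rw [beq_self_eq_true] at h2
    have h3 := orient_cases (D := D) (edgeAt p.1 Dir.east)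
    change _ = -(Dir.north.sign * D.orient (edgeAt p.1 Dir.north)) at h2
    rcases h3 with h3 | h3
    · right
      rw [h3] at h2
      revert h2
      generalize Dir.north.sign * D.orient (edgeAt p.1 Dir.north) = s
      revert s
      decide
    · left
      rw [h3]
      rfl
  rcases h1 with h1 | h1
  · exact key _ h1
  · have := key _ h1
    rw [← circleOf_north_eq_south_iff, Ne, ← circleOf_north_eq_south_iff u]
    exact this

/-- The circle `k` of `D_u` runs through the crossing `p`. -/
def Touches {u : D.State} (p : D.Crossing) (k : Circle u) : Prop :=
  k = circleOf u (D.arcAt p Dir.east) ∨ k = circleOf u (D.arcAt p Dir.west)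

theorem touches_arcAt (u : D.State) (p : D.Crossing) (d : Dir) :
    Touches p (circleOf u (D.arcAt p d)) := by
  unfold Touches
  have h := circleOf_arcAt u p d
  cases d
  · exact Or.inl rfl
  · rw [h]
    generalize (u p == D.horizontalOver p.1) = b
    cases b
    · exact Or.inr rfl
    · exact Or.inl rfl
  · exact Or.inr rfl
  · rw [h]
    generalize (u p == D.horizontalOver p.1) = b
    cases b
    · exact Or.inl rfl
    · exact Or.inr rfl

theorem circleOf_eq_flip {u v : D.State} {p : D.Crossing} (huv : ∀ q, q ≠ p → u q = v q)
    {e f : D.Arc} (h : circleOf u e = circleOf u f) :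
    circleOf v e = circleOf v f ∨ (Touches p (circleOf v e) ∧ Touches p (circleOf v f)) := by
  rw [circleOf_eq_iff_eqvGen] at h
  induction h with
  | rel e f h =>
    obtain ⟨w, d, d', hj, he, hf⟩ := h
    by_cases hw : w = p.1
    · subst hw
      right
      have h1 : e = D.arcAt p d := Subtype.ext he
      have h2 : f = D.arcAt p d' := Subtype.ext hf
      rw [h1, h2]
      exact ⟨touches_arcAt v p d, touches_arcAt v p d'⟩
    · exact Or.inl (Quot.sound ⟨w, d, d', joined_congr
        (fun h' => huv _ fun h => hw (congrArg Subtype.val h)) hj, he, hf⟩)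
  | refl e => exact Or.inl rfl
  | symm e f _ ih => exact ih.imp Eq.symm And.symm
  | trans e f g _ _ ih1 ih2 =>
    rcases ih1 with h1 | ⟨h1, h2⟩
    · rwa [h1]
    · rcases ih2 with h3 | ⟨_, h4⟩
      · exact Or.inr ⟨h1, h3 ▸ h2⟩
      · exact Or.inr ⟨h1, h4⟩

theorem circleOf_eq_of_merge {u v : D.State} {p : D.Crossing} (huv : ∀ q, q ≠ p → u q = v q)
    (hm : circleOf v (D.arcAt p Dir.east) = circleOf v (D.arcAt p Dir.west))
    {e f : D.Arc} (h : circleOf u e = circleOf u f) : circleOf v e = circleOf v f := by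
  rcases circleOf_eq_flip huv h with h | ⟨h1 | h1, h2 | h2⟩
  · exact h
  · rw [h1, h2]
  · rw [h1, h2, hm]
  · rw [h1, h2, hm]
  · rw [h1, h2]

/-- The circle of `D_v` that contains a circle of `D_u`, if `D_v` is obtained by merging circles
of `D_u`. -/
def circleMap (u v : D.State) (k : Circle u) : Circle v := circleOf v (Quot.out k)

theorem circleOf_out {u : D.State} (k : Circle u) : circleOf u (Quot.out k) = k := Quot.out_eq k

theorem circleMap_circleOf {u v : D.State} {p : D.Crossing} (huv : ∀ q, q ≠ p → u q = v q)
    (hm : circleOf v (D.arcAt p Dir.east) = circleOf v (D.arcAt p Dir.west)) (e : D.Arc) :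
    circleMap u v (circleOf u e) = circleOf v e :=
  circleOf_eq_of_merge huv hm (circleOf_out _)

theorem circleMap_surjective {u v : D.State} {p : D.Crossing} (huv : ∀ q, q ≠ p → u q = v q)
    (hm : circleOf v (D.arcAt p Dir.east) = circleOf v (D.arcAt p Dir.west)) :
    Function.Surjective (circleMap u v) := by
  intro c
  obtain ⟨e, rfl⟩ := Quot.exists_rep c
  exact ⟨circleOf u e, circleMap_circleOf huv hm e⟩

theorem circleMap_eq {u v : D.State} {p : D.Crossing} (huv : ∀ q, q ≠ p → u q = v q)
    {k k' : Circle u} (h : circleMap u v k = circleMap u v k') :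
    k = k' ∨ (Touches p k ∧ Touches p k') := by
  have := circleOf_eq_flip (fun q hq => (huv q hq).symm) h
  rwa [circleOf_out, circleOf_out] at this

end AnnularDiagram

@[to_additive]
theorem prod_comp_of_merge {A B M : Type*} [Fintype A] [Fintype B] [CommMonoid M]
    {π : A → B} (hπ : Function.Surjective π) {a₀ a₁ : A} (hne : a₀ ≠ a₁) (h01 : π a₀ = π a₁)
    (hinj : ∀ k k', π k = π k' → k = k' ∨ ((k = a₀ ∨ k = a₁) ∧ (k' = a₀ ∨ k' = a₁)))
    (g : B → M) : ∏ a, g (π a) = g (π a₀) * ∏ b, g b := by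
  classical
  rw [← Finset.mul_prod_erase _ _ (Finset.mem_univ a₀)]
  congr 1
  refine Finset.prod_nbij π (fun _ _ => Finset.mem_univ _) ?_ ?_ fun _ _ => rfl
  · intro k hk k' hk' h
    have hk := Finset.ne_of_mem_erase (Finset.mem_coe.1 hk)
    have hk' := Finset.ne_of_mem_erase (Finset.mem_coe.1 hk')
    rcases hinj k k' h with h | ⟨h1, h2⟩
    · exact h
    · rw [h1.resolve_left hk, h2.resolve_left hk']
  · intro b _
    obtain ⟨a, rfl⟩ := hπ b
    by_cases ha : a = a₀
    · exact ⟨a₁, by simpa using hne.symm, by rw [ha, h01]⟩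
    · exact ⟨a, by simpa using ha, rfl⟩

/-! ## The idempotents of the Frobenius algebra -/

/-- The element `X - α_i`, a multiple of `e_i`. -/
def xsub (i : Fin 2) : Aα := Xα - algebraMap Rα Aα (α i)

/-- The differences `α₁ - α₀` (for `i = 0`) and `α₀ - α₁` (for `i = 1`). -/
def diffα (i : Fin 2) : Rα := α (1 - i) - α i

theorem xsub_zero_mul_xsub_one : xsub 0 * xsub 1 = 0 := by
  have h : AdjoinRoot.mk quadα ((Polynomial.X - Polynomial.C (α 0)) *
      (Polynomial.X - Polynomial.C (α 1))) = 0 := AdjoinRoot.mk_self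
  rw [map_mul, map_sub, map_sub, AdjoinRoot.mk_X, AdjoinRoot.mk_C, AdjoinRoot.mk_C] at h
  exact h

theorem xsub_mul_of_ne {i j : Fin 2} (h : i ≠ j) : xsub i * xsub j = 0 := by
  fin_cases i <;> fin_cases j
  · exact absurd rfl h
  · exact xsub_zero_mul_xsub_one
  · exact (mul_comm _ _).trans xsub_zero_mul_xsub_one
  · exact absurd rfl h

theorem xsub_mul_self (i : Fin 2) : xsub i * xsub i = diffα i • xsub i := by
  have h1 : xsub i = xsub (1 - i) + algebraMap Rα Aα (diffα i) := by
    unfold xsub diffα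
    rw [map_sub]
    ring
  have h2 : xsub i * xsub (1 - i) = 0 := xsub_mul_of_ne (by fin_cases i <;> decide)
  conv_lhs => rw [h1]
  rw [add_mul, ← h1, mul_comm, h2, zero_add, Algebra.smul_def]

theorem xsub_pow (i : Fin 2) (n : ℕ) : xsub i ^ (n + 1) = diffα i ^ n • xsub i := by
  induction n with
  | zero => simp
  | succ n ih => rw [pow_succ, ih, smul_mul_assoc, xsub_mul_self, smul_smul, pow_succ]

theorem invDiff_mul_diffα (i : Fin 2) : invDiff i * algebraMap Rα RαD (diffα i) = 1 :=
  Ring.inverse_mul_cancel _ (isUnit_diff i)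

theorem comulα_one : comulα 1 = xsub 0 ⊗ₜ 1 + 1 ⊗ₜ xsub 1 := by
  unfold comulα
  rw [← basisX_zero, Module.Basis.constr_basis, basisX_zero]
  rfl

theorem comulα_X : comulα Xα = Xα ⊗ₜ Xα - (α 0 * α 1) • (1 ⊗ₜ 1) := by
  unfold comulα
  rw [← basisX_one, Module.Basis.constr_basis, basisX_one]
  rfl

theorem comulα_xsub (i : Fin 2) : comulα (xsub i) = xsub i ⊗ₜ xsub i := by
  have h : ∀ r : Rα, comulα (Xα - algebraMap Rα Aα r) = comulα Xα - r • comulα 1 := by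
    intro r
    rw [map_sub, Algebra.algebraMap_eq_smul_one, map_smul]
  unfold xsub
  rw [h, comulα_one, comulα_X]
  unfold xsub
  simp only [Algebra.algebraMap_eq_smul_one, TensorProduct.sub_tmul, TensorProduct.tmul_sub,
    ← TensorProduct.smul_tmul', TensorProduct.tmul_smul, smul_add, smul_sub, smul_smul]
  fin_cases i <;> simp only [Fin.zero_eta, Fin.mk_one] <;> module

namespace AnnularDiagram

variable {D : AnnularDiagram}

/-! ## The saddle maps on tensor products -/

theorem stdBasis_apply (u : D.State) (l : Circle u → Fin 2) :
    stdBasis u l = ⨂ₜ[Rα] C, basisX (l C) := Basis.piTensorProduct_apply _ _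

open scoped Classical in
theorem fibreProd_update {A B : Type*} [Fintype A] [DecidableEq A] (π : A → B) (x : A → Aα)
    (a : A) (y : Aα) : (fun b => ∏ a' with π a' = b, Function.update x a y a') =
      Function.update (fun b => ∏ a' with π a' = b, x a') (π a)
        (y * ∏ a' ∈ (Finset.univ.filter fun a' => π a' = π a).erase a, x a') := by
  funext b
  by_cases hb : b = π a
  · subst hb
    rw [Function.update_self, ← Finset.mul_prod_erase _ _ (a := a) (by simp),
      Function.update_self]
    congr 1
    exact Finset.prod_congr rfl fun k hk =>
      Function.update_of_ne (Finset.ne_of_mem_erase hk) _ _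
  · rw [Function.update_of_ne hb]
    refine Finset.prod_congr rfl fun k hk => Function.update_of_ne ?_ _ _
    rintro rfl
    exact hb (Finset.mem_filter.1 hk).2.symm

open scoped Classical in
/-- The tensor product over `B` of the products along the fibres of a map `A → B`. -/
def fibreProd {A B : Type*} [Fintype A] (π : A → B) :
    MultilinearMap Rα (fun _ : A => Aα) (⨂[Rα] _ : B, Aα) where
  toFun x := ⨂ₜ[Rα] b, ∏ a with π a = b, x a
  map_update_add' {_} x a y z := by
    simp only [fibreProd_update, add_mul]
    exact MultilinearMap.map_update_add _ _ _ _ _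
  map_update_smul' {_} x a r y := by
    simp only [fibreProd_update, smul_mul_assoc]
    exact MultilinearMap.map_update_smul _ _ _ _ _

theorem multilinear_ext_basisX {A N : Type*} [Finite A] [AddCommGroup N] [Module Rα N]
    {f g : MultilinearMap Rα (fun _ : A => Aα) N}
    (h : ∀ l : A → Fin 2, f (fun a => basisX (l a)) = g (fun a => basisX (l a))) : f = g :=
  Module.Basis.ext_multilinear (fun _ => basisX) h

open scoped Classical in
theorem mergeMap_tprod {u v : D.State} {p : D.Crossing} (huv : ∀ q, q ≠ p → u q = v q)
    (hm : circleOf v (D.arcAt p Dir.east) = circleOf v (D.arcAt p Dir.west))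
    (x : Circle u → Aα) :
    mergeMap u v (⨂ₜ[Rα] k, x k) = ⨂ₜ[Rα] c, ∏ k with circleMap u v k = c, x k := by
  have h : (mergeMap u v).compMultilinearMap (PiTensorProduct.tprod Rα) =
      fibreProd (circleMap u v) := by
    refine multilinear_ext_basisX fun l => ?_
    rw [LinearMap.compMultilinearMap_apply, ← stdBasis_apply, mergeMap,
      Module.Basis.constr_basis]
    refine congrArg _ (funext fun c => Finset.prod_congr (Finset.filter_congr fun k _ => ?_)
      fun _ _ => rfl)
    constructor
    · rintro ⟨e, rfl, rfl⟩
      exact circleMap_circleOf huv hm e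
    · intro h
      exact ⟨Quot.out k, circleOf_out k, h⟩
  exact congrArg (fun f => f x) h

theorem insertTwo_tmul {v : D.State} {c d : Circle v} (h : c ≠ d) (x : Circle v → Aα)
    (y z : Aα) : insertTwo c d h x (y ⊗ₜ z) =
      ⨂ₜ[Rα] k, Function.update (Function.update x c y) d z k := rfl

theorem insertTwo_congr {v : D.State} {c d : Circle v} (h : c ≠ d) {x x' : Circle v → Aα}
    (hx : ∀ k, k ≠ c → k ≠ d → x k = x' k) : insertTwo c d h x = insertTwo c d h x' := by
  refine TensorProduct.ext' fun y z => ?_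
  rw [insertTwo_tmul, insertTwo_tmul]
  congr 1
  funext k
  by_cases hd : k = d
  · rw [hd, Function.update_self, Function.update_self]
  · rw [Function.update_of_ne hd, Function.update_of_ne hd]
    by_cases hc : k = c
    · rw [hc, Function.update_self, Function.update_self]
    · rw [Function.update_of_ne hc, Function.update_of_ne hc, hx k hc hd]

theorem insertTwo_update_add {v : D.State} {c d : Circle v} (h : c ≠ d) (x : Circle v → Aα)
    {k : Circle v} (hc : k ≠ c) (hd : k ≠ d) (y z : Aα) :
    insertTwo c d h (Function.update x k (y + z)) =
      insertTwo c d h (Function.update x k y) + insertTwo c d h (Function.update x k z) := by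
  refine TensorProduct.ext' fun a b => ?_
  rw [LinearMap.add_apply, insertTwo_tmul, insertTwo_tmul, insertTwo_tmul]
  simp only [Function.update_comm hc, Function.update_comm hd]
  exact MultilinearMap.map_update_add _ _ _ _ _

theorem insertTwo_update_smul {v : D.State} {c d : Circle v} (h : c ≠ d) (x : Circle v → Aα)
    {k : Circle v} (hc : k ≠ c) (hd : k ≠ d) (r : Rα) (y : Aα) :
    insertTwo c d h (Function.update x k (r • y)) =
      r • insertTwo c d h (Function.update x k y) := by
  refine TensorProduct.ext' fun a b => ?_
  rw [LinearMap.smul_apply, insertTwo_tmul, insertTwo_tmul]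
  simp only [Function.update_comm hc, Function.update_comm hd]
  exact MultilinearMap.map_update_smul _ _ _ _ _

/-- Pulling back along a map that sends exactly `c` and `d` to `a` and that is otherwise
bijective, with a linear function of the factor at `a` inserted at `c` and `d`. -/
def pullbackInsert {u v : D.State} {a : Circle u} {c d : Circle v} (h : c ≠ d)
    (π : Circle v → Circle u) (ha : ∀ k, π k = a ↔ k = c ∨ k = d)
    (hinj : ∀ k k', π k = π k' → π k ≠ a → k = k') (hsurj : Function.Surjective π)
    (Δ : Aα →ₗ[Rα] Aα ⊗[Rα] Aα) : MultilinearMap Rα (fun _ : Circle u => Aα) (TQFT v) :=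
  have key : ∀ (_ : DecidableEq (Circle u)) (x : Circle u → Aα) (j : Circle u), j ≠ a → ∃ k : Circle v, k ≠ c ∧ k ≠ d ∧
      ∀ y, (fun k' => Function.update x j y (π k')) = Function.update (fun k' => x (π k')) k y := by
    intro _ x j hj
    obtain ⟨k, rfl⟩ := hsurj j
    refine ⟨k, fun hk => hj ((ha k).2 (Or.inl hk)), fun hk => hj ((ha k).2 (Or.inr hk)),
      fun y => ?_⟩
    funext k'
    by_cases hk : k' = k
    · rw [hk, Function.update_self, Function.update_self]
    · rw [Function.update_of_ne hk, Function.update_of_ne]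
      exact fun hπ => hk (hinj k' k hπ (hπ ▸ hj))
  have keya : ∀ (_ : DecidableEq (Circle u)) (x : Circle u → Aα) (y : Aα),
      insertTwo c d h (fun k => Function.update x a y (π k)) =
        insertTwo c d h (fun k => x (π k)) := by
    intro _ x y
    refine insertTwo_congr h fun k hc hd => Function.update_of_ne ?_ _ _
    rw [Ne, ha]
    tauto
  { toFun := fun x => insertTwo c d h (fun k => x (π k)) (Δ (x a))
    map_update_add' := by
      intro inst x j y z
      by_cases hj : j = a
      · subst hj
        simp only [Function.update_self, keya inst x, map_add]
      · obtain ⟨k, hc, hd, hk⟩ := key inst x j hj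
        simp only [Function.update_of_ne (Ne.symm hj), hk, insertTwo_update_add h _ hc hd,
          LinearMap.add_apply]
    map_update_smul' := by
      intro inst x j r y
      by_cases hj : j = a
      · subst hj
        simp only [Function.update_self, keya inst x, map_smul]
      · obtain ⟨k, hc, hd, hk⟩ := key inst x j hj
        simp only [Function.update_of_ne (Ne.symm hj), hk, insertTwo_update_smul h _ hc hd,
          LinearMap.smul_apply] }

theorem splitMap_tprod {u v : D.State} {p : D.Crossing} (huv : ∀ q, q ≠ p → u q = v q)
    (hm : circleOf u (D.arcAt p Dir.east) = circleOf u (D.arcAt p Dir.west))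
    (h : circleOf v (D.arcAt p Dir.east) ≠ circleOf v (D.arcAt p Dir.west))
    (x : Circle u → Aα) :
    splitMap u v (circleOf u (D.arcAt p Dir.east)) _ _ h (⨂ₜ[Rα] k, x k) =
      insertTwo _ _ h (fun k => x (circleMap v u k))
        (comulα (x (circleOf u (D.arcAt p Dir.east)))) := by
  have hvu : ∀ q, q ≠ p → v q = u q := fun q hq => (huv q hq).symm
  have hE := circleMap_circleOf hvu hm (D.arcAt p Dir.east)
  have hW := circleMap_circleOf hvu hm (D.arcAt p Dir.west)
  have ha : ∀ k, circleMap v u k = circleOf u (D.arcAt p Dir.east) ↔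
      k = circleOf v (D.arcAt p Dir.east) ∨ k = circleOf v (D.arcAt p Dir.west) := by
    intro k
    constructor
    · intro hk
      rw [← hE] at hk
      rcases circleMap_eq hvu hk with h | ⟨h, -⟩
      · exact Or.inl h
      · exact h
    · rintro (rfl | rfl)
      · exact hE
      · rw [hW, hm]
  have hinj : ∀ k k', circleMap v u k = circleMap v u k' →
      circleMap v u k ≠ circleOf u (D.arcAt p Dir.east) → k = k' := by
    intro k k' hk hne
    rcases circleMap_eq hvu hk with h | ⟨h, -⟩
    · exact h
    · exact absurd ((ha k).2 h) hne
  have key : (splitMap u v (circleOf u (D.arcAt p Dir.east)) _ _ h).compMultilinearMap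
      (PiTensorProduct.tprod Rα) =
        pullbackInsert h (circleMap v u) ha hinj (circleMap_surjective hvu hm) comulα := by
    refine multilinear_ext_basisX fun l => ?_
    rw [LinearMap.compMultilinearMap_apply, ← stdBasis_apply, splitMap,
      Module.Basis.constr_basis]
    rfl
  exact congrArg (fun f => f x) key

theorem raise_off {u : D.State} {p : D.Crossing} (q : D.Crossing) (hq : q ≠ p) :
    u q = raise u p q := (Function.update_of_ne hq _ _).symm

theorem raise_self {u : D.State} {p : D.Crossing} (hp : u p = false) : raise u p p = !u p := by
  rw [hp]
  exact Function.update_self _ _ _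

theorem pureTensor_smul {u : D.State} (s : Circle u → RαD) (r : Circle u → Rα)
    (x : Circle u → Aα) : pureTensor s (fun C => r C • x C) =
      pureTensor (fun C => s C * algebraMap Rα RαD (r C)) x := by
  unfold pureTensor
  rw [MultilinearMap.map_smul_univ, TensorProduct.tmul_smul, TensorProduct.smul_tmul',
    Algebra.smul_def, map_prod, ← Finset.prod_mul_distrib]
  simp only [mul_comm]

open scoped Classical in
/-- The coefficient of a saddle map on the tensor products of the idempotents. -/
def saddleCoef (u : D.State) (p : D.Crossing) (i : Fin 2) : RαD :=
  if circleOf u (D.arcAt p Dir.east) = circleOf u (D.arcAt p Dir.west) then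
    algebraMap Rα RαD (diffα i)
  else 1

theorem circleMap_circleMap {u v : D.State} {p : D.Crossing} (huv : ∀ q, q ≠ p → u q = v q)
    (hm : circleOf v (D.arcAt p Dir.east) = circleOf v (D.arcAt p Dir.west)) (c : Circle v) :
    circleMap u v (circleMap v u c) = c := by
  conv_rhs => rw [← circleOf_out c]
  exact circleMap_circleOf huv hm _

/-- A labelling that takes the same value on the circles through `p` factors through the circles
after the saddle at `p`. -/
theorem label_circleMap {u v : D.State} {p : D.Crossing} (huv : ∀ q, q ≠ p → u q = v q)
    (hm : circleOf v (D.arcAt p Dir.east) = circleOf v (D.arcAt p Dir.west)) {T : Type*}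
    {l : Circle u → T}
    (hl : l (circleOf u (D.arcAt p Dir.east)) = l (circleOf u (D.arcAt p Dir.west)))
    (k : Circle u) : l (circleMap v u (circleMap u v k)) = l k := by
  rcases circleMap_eq huv (circleMap_circleMap huv hm (circleMap u v k)) with h | ⟨h1, h2⟩
  · rw [h]
  · have h3 : ∀ j : Circle u, Touches p j → l j = l (circleOf u (D.arcAt p Dir.east)) := by
      rintro j (rfl | rfl)
      · rfl
      · exact hl.symm
    rw [h3 _ h1, h3 _ h2]

open scoped Classical in
theorem saddle_planarGenerator {u : D.State} {p : D.Crossing} (hp : u p = false)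
    (l : Circle u → Fin 2) :
    (saddle u p).baseChange RαD (planarGenerator u l) =
      if l (circleOf u (D.arcAt p Dir.east)) = l (circleOf u (D.arcAt p Dir.west)) then
        saddleCoef u p (l (circleOf u (D.arcAt p Dir.east))) •
          planarGenerator (raise u p) (fun c => l (circleMap (raise u p) u c))
      else 0 := by
  have huv := raise_off (u := u) (p := p)
  have hfl := circleOf_flip huv (raise_self hp)
  set v := raise u p with hv
  unfold planarGenerator
  rw [pureTensor, LinearMap.baseChange_tmul]
  by_cases hm : circleOf u (D.arcAt p Dir.east) = circleOf u (D.arcAt p Dir.west)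
  · have hne : circleOf v (D.arcAt p Dir.east) ≠ circleOf v (D.arcAt p Dir.west) :=
      fun h => hfl.1 h hm
    have hvu : ∀ q, q ≠ p → v q = u q := fun q hq => (huv q hq).symm
    rw [if_pos (congrArg l hm), saddleCoef, if_pos hm]
    have hs : saddle u p = splitMap u v (circleOf u (D.arcAt p Dir.east)) _ _ hne := by
      unfold saddle
      rw [if_neg (not_not.2 hm), dif_pos hne]
    have h1 := comulα_xsub (l (circleOf u (D.arcAt p Dir.east)))
    unfold xsub at h1
    have hE := circleMap_circleOf hvu hm (D.arcAt p Dir.east)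
    have hW := circleMap_circleOf hvu hm (D.arcAt p Dir.west)
    rw [hs, splitMap_tprod huv hm hne, h1, insertTwo_tmul, pureTensor, TensorProduct.smul_tmul',
      smul_eq_mul]
    congr 1
    · have h2 := prod_comp_of_merge (circleMap_surjective hvu hm) hne
        (hE.trans (hm.trans hW.symm))
        (fun k k' h => circleMap_eq hvu h) (fun C => invDiff (l C))
      rw [h2, hE, ← mul_assoc, mul_comm (algebraMap _ _ _), invDiff_mul_diffα, one_mul]
    · congr 1
      funext k
      change _ = Xα - algebraMap Rα Aα (α (l (circleMap v u k)))
      by_cases hkW : k = circleOf v (D.arcAt p Dir.west)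
      · rw [hkW, Function.update_self, hW, hm]
      · rw [Function.update_of_ne hkW]
        by_cases hkE : k = circleOf v (D.arcAt p Dir.east)
        · rw [hkE, Function.update_self, hE]
        · rw [Function.update_of_ne hkE]
  · have hmv := hfl.2 hm
    have hs : saddle u p = mergeMap u v := by
      unfold saddle
      rw [if_pos hm]
    rw [hs, mergeMap_tprod huv hmv, saddleCoef, if_neg hm, one_smul]
    split_ifs with hl
    · have h1 : ∀ c, ∏ k with circleMap u v k = c, (Xα - algebraMap Rα Aα (α (l k))) =
          diffα (l (circleMap v u c)) ^
            ((Finset.univ.filter fun k => circleMap u v k = c).card - 1) •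
              xsub (l (circleMap v u c)) := by
        intro c
        rw [← xsub_pow, Nat.sub_add_cancel, ← Finset.prod_const]
        · refine Finset.prod_congr rfl fun k hk => ?_
          rw [← (Finset.mem_filter.1 hk).2, label_circleMap huv hmv hl]
          rfl
        · obtain ⟨k, hk⟩ := circleMap_surjective huv hmv c
          exact Finset.card_pos.2 ⟨k, by simp [hk]⟩
      simp only [h1]
      have h2 : ∏ C, invDiff (l C) = ∏ c : Circle v, invDiff (l (circleMap v u c)) ^
          (Finset.univ.filter fun k => circleMap u v k = c).card := by
        rw [← Finset.prod_fiberwise Finset.univ (circleMap u v)]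
        refine Finset.prod_congr rfl fun c _ => ?_
        rw [← Finset.prod_const]
        refine Finset.prod_congr rfl fun k hk => ?_
        rw [← (Finset.mem_filter.1 hk).2, label_circleMap huv hmv hl]
      rw [h2]
      refine (pureTensor_smul _ _ _).trans ?_
      unfold xsub
      congr 1
      funext c
      obtain ⟨k, hk⟩ := circleMap_surjective huv hmv c
      obtain ⟨n, hn⟩ : ∃ n, (Finset.univ.filter fun k => circleMap u v k = c).card = n + 1 :=
        Nat.exists_eq_succ_of_ne_zero (Finset.card_pos.2 ⟨k, by simp [hk]⟩).ne'
      rw [hn, Nat.add_sub_cancel, map_pow, pow_succ, mul_right_comm, ← mul_pow,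
        invDiff_mul_diffα, one_pow, one_mul]
    · have hE := circleMap_circleOf huv hmv (D.arcAt p Dir.east)
      have hW := circleMap_circleOf huv hmv (D.arcAt p Dir.west)
      rw [MultilinearMap.map_coord_zero _ (circleOf v (D.arcAt p Dir.east)),
        TensorProduct.tmul_zero]
      rw [← Finset.mul_prod_erase _ _ (a := circleOf u (D.arcAt p Dir.east)) (by simp [hE]),
        ← Finset.mul_prod_erase _ _ (a := circleOf u (D.arcAt p Dir.west))
          (by simp [hW, hmv, Ne.symm hm]), ← mul_assoc]
      have := xsub_mul_of_ne hl
      unfold xsub at this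
      rw [this, zero_mul]

/-! ## The bases of the modules of a smoothing -/

/-- The tensor product over the circles of elements of `A_{αD}` with given coordinates in the
basis `1`, `X`. -/
def tensorVec {u : D.State} (y : Circle u → Fin 2 → RαD) : TQFTD u :=
  ∑ m : Circle u → Fin 2, (∏ C, y C (m C)) • ((1 : RαD) ⊗ₜ[Rα] stdBasis u m)

theorem pureTensor_eq_tensorVec {u : D.State} (s : Circle u → RαD) (x : Circle u → Aα) :
    pureTensor s x = tensorVec fun C m => s C * algebraMap Rα RαD (basisX.repr (x C) m) := by
  unfold pureTensor tensorVec
  conv_lhs => rw [← (stdBasis u).sum_repr (⨂ₜ[Rα] C, x C), TensorProduct.tmul_sum]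
  refine Finset.sum_congr rfl fun m _ => ?_
  rw [stdBasis, Basis.piTensorProduct_repr_tprod_apply, TensorProduct.tmul_smul,
    TensorProduct.smul_tmul', TensorProduct.smul_tmul', smul_eq_mul, mul_one,
    Finset.prod_mul_distrib, Algebra.smul_def, map_prod, mul_comm]

theorem tensorVec_expand {u : D.State} {y : Circle u → Fin 2 → RαD}
    (A : Circle u → Fin 2 → RαD) (z : Circle u → Fin 2 → Fin 2 → RαD)
    (h : ∀ C n, y C n = ∑ j, A C j * z C j n) :
    tensorVec y = ∑ m : Circle u → Fin 2, (∏ C, A C (m C)) • tensorVec fun C => z C (m C) := by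
  unfold tensorVec
  simp only [Finset.smul_sum, smul_smul]
  rw [Finset.sum_comm]
  refine Finset.sum_congr rfl fun n _ => ?_
  rw [← Finset.sum_smul]
  congr 1
  simp only [h]
  rw [Finset.prod_univ_sum, Fintype.piFinset_univ]
  exact Finset.sum_congr rfl fun m _ => Finset.prod_mul_distrib

/-- The coordinates of `1`. -/
def oneVec : Fin 2 → RαD := ![1, 0]

/-- The coordinates of `e_i`. -/
def eVec (i : Fin 2) : Fin 2 → RαD := ![-(invDiff i * algebraMap Rα RαD (α i)), invDiff i]

theorem repr_one (m : Fin 2) : algebraMap Rα RαD (basisX.repr 1 m) = oneVec m := by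
  rw [← basisX_zero, Module.Basis.repr_self]
  fin_cases m <;> simp [oneVec]

theorem repr_xsub (i m : Fin 2) :
    invDiff i * algebraMap Rα RαD (basisX.repr (Xα - algebraMap Rα Aα (α i)) m) = eVec i m := by
  rw [show algebraMap Rα Aα (α i) = α i • (1 : Aα) from Algebra.algebraMap_eq_smul_one _,
    map_sub, map_smul, ← basisX_zero, ← basisX_one,
    Module.Basis.repr_self, Module.Basis.repr_self]
  fin_cases m <;> simp [eVec]

theorem planarGenerator_eq_tensorVec (u : D.State) (l : Circle u → Fin 2) :
    planarGenerator u l = tensorVec fun C => eVec (l C) := by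
  unfold planarGenerator
  rw [pureTensor_eq_tensorVec]
  simp only [repr_xsub]

/-- The label `i` of the circle `C` corresponds to the element `1`. -/
def Low {u : D.State} (C : Circle u) (i : Fin 2) : Prop :=
  IsEssential C ∧ if Odd (essentialIndex C) then i = 1 else i = 0

open scoped Classical in
theorem labelElement_eq {u : D.State} (C : Circle u) (i : Fin 2) :
    labelElement C i = if Low C i then (1, 1) else (invDiff i, Xα - algebraMap Rα Aα (α i)) := by
  unfold labelElement Low
  by_cases h1 : IsEssential C <;> by_cases h2 : Odd (essentialIndex C) <;> fin_cases i <;>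
    simp only [h1, h2, if_true, if_false, true_and, false_and] <;> simp

theorem not_low_of_low {u : D.State} {C : Circle u} {i j : Fin 2} (h : Low C i) (hij : i ≠ j) :
    ¬ Low C j := by
  unfold Low at *
  rintro ⟨_, h'⟩
  split_ifs at h h'
  · exact hij (h.2.trans h'.symm)
  · exact hij (h.2.trans h'.symm)

open scoped Classical in
/-- The coordinates of the element that corresponds to a label. -/
def labelVec {u : D.State} (C : Circle u) (i : Fin 2) : Fin 2 → RαD :=
  if Low C i then oneVec else eVec i

theorem annularGenerator_eq_tensorVec (u : D.State) (l : Circle u → Fin 2) :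
    annularGenerator u l = tensorVec fun C => labelVec C (l C) := by
  classical
  unfold annularGenerator
  rw [pureTensor_eq_tensorVec]
  congr 1
  funext C m
  rw [labelElement_eq, labelVec]
  split_ifs
  · rw [one_mul, repr_one]
  · exact repr_xsub _ _

theorem invDiff_one_eq : invDiff 1 = -invDiff 0 := by
  have h : diffα 1 = -diffα 0 := by
    unfold diffα
    simp
  have h0 := invDiff_mul_diffα 0
  have h1 := invDiff_mul_diffα 1
  rw [h, map_neg] at h1
  have h2 := congrArg (fun z => z * invDiff 0) h1
  simp only [one_mul] at h2
  rw [← h2, mul_neg, neg_mul, neg_neg, mul_assoc, mul_comm (algebraMap _ _ _), h0, mul_one]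

theorem invDiff_rel : invDiff 0 * algebraMap Rα RαD (α 1) =
    1 + invDiff 0 * algebraMap Rα RαD (α 0) := by
  have h := invDiff_mul_diffα 0
  have h2 : diffα 0 = α 1 - α 0 := rfl
  rw [h2, map_sub, mul_sub] at h
  linear_combination h

theorem oneVec_eq (n : Fin 2) : oneVec n = eVec 0 n + eVec 1 n := by
  have h := invDiff_rel
  fin_cases n
  · simp [oneVec, eVec, invDiff_one_eq]
    linear_combination -h
  · simp [oneVec, eVec, invDiff_one_eq]

theorem xVec_eq (n : Fin 2) : (![0, 1] : Fin 2 → RαD) n =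
    algebraMap Rα RαD (α 1) * eVec 0 n + algebraMap Rα RαD (α 0) * eVec 1 n := by
  have h := invDiff_rel
  fin_cases n
  · simp [eVec, invDiff_one_eq]
    ring
  · simp [eVec, invDiff_one_eq]
    linear_combination -h

open scoped Classical in
/-- The coordinates of the elements that correspond to labels in terms of the idempotents
(for `ε = 1`) and conversely (for `ε = -1`). -/
def labelCoef {u : D.State} (ε : ℤ) (C : Circle u) (i j : Fin 2) : ℤ :=
  if i = j then 1 else if Low C i then ε else 0

theorem labelVec_eq {u : D.State} (C : Circle u) (i n : Fin 2) :
    labelVec C i n = ∑ j, ((labelCoef 1 C i j : ℤ) : RαD) * eVec j n := by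
  classical
  unfold labelVec labelCoef
  have h := oneVec_eq n
  by_cases hl : Low C i <;> fin_cases i <;> simp only [hl, if_true, if_false] <;>
    simp [h]

theorem eVec_eq {u : D.State} (C : Circle u) (i n : Fin 2) :
    eVec i n = ∑ j, ((labelCoef (-1) C i j : ℤ) : RαD) * labelVec C j n := by
  classical
  have h := oneVec_eq n
  by_cases hl : Low C i
  · have hn := fun j (hj : i ≠ j) => not_low_of_low hl hj
    unfold labelVec labelCoef
    fin_cases i
    · have := hn 1 (by decide)
      simp at hl
      simp [hl, this, h]
    · have := hn 0 (by decide)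
      simp at hl
      simp [hl, this, h]
  · unfold labelVec labelCoef
    fin_cases i <;> simp at hl <;> simp [hl]

theorem annularGenerator_eq_sum (u : D.State) (l : Circle u → Fin 2) :
    annularGenerator u l = ∑ m : Circle u → Fin 2,
      (∏ C, ((labelCoef 1 C (l C) (m C) : ℤ) : RαD)) • planarGenerator u m := by
  rw [annularGenerator_eq_tensorVec, tensorVec_expand _ _ fun C n => labelVec_eq C (l C) n]
  simp only [planarGenerator_eq_tensorVec]

theorem planarGenerator_eq_sum (u : D.State) (l : Circle u → Fin 2) :
    planarGenerator u l = ∑ m : Circle u → Fin 2,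
      (∏ C, ((labelCoef (-1) C (l C) (m C) : ℤ) : RαD)) • annularGenerator u m := by
  rw [planarGenerator_eq_tensorVec, tensorVec_expand _ _ fun C n => eVec_eq C (l C) n]
  simp only [annularGenerator_eq_tensorVec]

/-- The coordinates of `1` and `X` in terms of the idempotents. -/
def stdCoef (j i : Fin 2) : RαD := if j = 0 then 1 else algebraMap Rα RαD (α (1 - i))

theorem stdBasis_eq_sum (u : D.State) (l : Circle u → Fin 2) :
    (1 : RαD) ⊗ₜ[Rα] stdBasis u l = ∑ m : Circle u → Fin 2,
      (∏ C, stdCoef (l C) (m C)) • planarGenerator u m := by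
  have h1 : (1 : RαD) ⊗ₜ[Rα] stdBasis u l =
      pureTensor (fun _ => 1) (fun C => basisX (l C)) := by
    rw [pureTensor, Finset.prod_const_one, stdBasis_apply]
  rw [h1, pureTensor_eq_tensorVec, tensorVec_expand (fun C i => stdCoef (l C) i)
    (fun _ i => eVec i)]
  · simp only [planarGenerator_eq_tensorVec]
  · intro C n
    generalize l C = j
    rw [Module.Basis.repr_self, Fin.sum_univ_two, one_mul]
    have h2 := oneVec_eq n
    have h3 := xVec_eq n
    fin_cases j
    · simp only [stdCoef, Fin.zero_eta, if_true, one_mul]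
      rw [← h2]
      fin_cases n <;> simp [oneVec]
    · simp only [stdCoef, Fin.mk_one, one_ne_zero, if_false, sub_zero, sub_self]
      rw [← h3]
      fin_cases n <;> simp

/-- The basis `1 ⊗ stdBasis` over `R_{αD}`. -/
def stdBasisD (u : D.State) : Module.Basis (Circle u → Fin 2) RαD (TQFTD u) :=
  (stdBasis u).baseChange RαD

theorem stdBasisD_apply (u : D.State) (l : Circle u → Fin 2) :
    stdBasisD u l = (1 : RαD) ⊗ₜ[Rα] stdBasis u l := Module.Basis.baseChange_apply _ _ _

theorem linearIndependent_of_span {u : D.State} {F : (Circle u → Fin 2) → TQFTD u}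
    (h : Submodule.span RαD (Set.range F) = ⊤) : LinearIndependent RαD F := by
  have : Module.Finite RαD (TQFTD u) := Module.Finite.of_basis (stdBasisD u)
  let T := (stdBasisD u).constr RαD F
  have hT : ∀ l, T (stdBasisD u l) = F l := fun l => (stdBasisD u).constr_basis RαD F l
  have hs : Function.Surjective T := by
    rw [← LinearMap.range_eq_top, ← h, (stdBasisD u).constr_range]
  have hi : Function.Injective T := OrzechProperty.injective_of_surjective_endomorphism T hs
  have := (stdBasisD u).linearIndependent.map' T (LinearMap.ker_eq_bot.2 hi)
  rw [← show ⇑T ∘ ⇑(stdBasisD u) = F from funext hT]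
  exact this

theorem planarGenerator_span (u : D.State) :
    Submodule.span RαD (Set.range (planarGenerator u)) = ⊤ := by
  rw [eq_top_iff, ← (stdBasisD u).span_eq, Submodule.span_le]
  rintro _ ⟨l, rfl⟩
  rw [stdBasisD_apply, stdBasis_eq_sum]
  exact Submodule.sum_mem _ fun m _ => Submodule.smul_mem _ _ (Submodule.subset_span ⟨m, rfl⟩)

theorem annularGenerator_span (u : D.State) :
    Submodule.span RαD (Set.range (annularGenerator u)) = ⊤ := by
  rw [eq_top_iff, ← planarGenerator_span, Submodule.span_le]
  rintro _ ⟨l, rfl⟩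
  rw [planarGenerator_eq_sum]
  exact Submodule.sum_mem _ fun m _ => Submodule.smul_mem _ _ (Submodule.subset_span ⟨m, rfl⟩)

/-- The basis of the tensor products of idempotents. -/
def planarBasisD (u : D.State) : Module.Basis (Circle u → Fin 2) RαD (TQFTD u) :=
  Module.Basis.mk (linearIndependent_of_span (planarGenerator_span u))
    (planarGenerator_span u).ge

theorem planarBasisD_apply (u : D.State) (l : Circle u → Fin 2) :
    planarBasisD u l = planarGenerator u l := Module.Basis.mk_apply _ _ _

/-- The basis of the elements given by labellings. -/
def annularBasisD (u : D.State) : Module.Basis (Circle u → Fin 2) RαD (TQFTD u) :=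
  Module.Basis.mk (linearIndependent_of_span (annularGenerator_span u))
    (annularGenerator_span u).ge

theorem annularBasisD_apply (u : D.State) (l : Circle u → Fin 2) :
    annularBasisD u l = annularGenerator u l := Module.Basis.mk_apply _ _ _

/-! ## The annular degree of a labelling -/

open scoped Classical in
/-- The annular degree of the element that corresponds to a label. -/
def labelDeg {u : D.State} (C : Circle u) (i : Fin 2) : ℤ :=
  if IsEssential C then (if Low C i then -1 else 1) else 0

/-- The annular degree of the element given by a labelling. -/
def labellingDeg {u : D.State} (l : Circle u → Fin 2) : ℤ := ∑ C, labelDeg C (l C)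

theorem labelDeg_eq {u : D.State} (C : Circle u) (i : Fin 2) :
    labelDeg C i = (paritySign (D.height (0, 0)) : ℤ) * winding C D.arcOrient *
      (if i = 0 then 1 else -1) := by
  classical
  rw [winding_eq_circleWinding]
  unfold labelDeg
  by_cases h : IsEssential C
  · rw [if_pos h, circleWinding_of_isEssential h]
    have hs : (paritySign (D.height (0, 0)) : ℤ) = 1 ∨ (paritySign (D.height (0, 0)) : ℤ) = -1 := by
      unfold paritySign
      split_ifs <;> simp
    unfold Low
    generalize (paritySign (D.height (0, 0)) : ℤ) = s at hs
    by_cases h2 : Odd (essentialIndex C) <;> fin_cases i <;> simp only [h, h2] <;>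
      rcases hs with rfl | rfl <;> simp
  · rw [if_neg h]
    rw [isEssential_iff, not_not] at h
    rw [h, mul_zero, zero_mul]

open scoped Classical in
/-- The annular degree of a labelling in terms of the labels of the edges on the ray. -/
theorem labellingDeg_eq {u : D.State} (l : Circle u → Fin 2) :
    labellingDeg l = (paritySign (D.height (0, 0)) : ℤ) * ∑ e : D.Arc,
      if ∃ n, e.1 = rayEdge n then
        (D.arcOrient e : ℤ) * (if l (circleOf u e) = 0 then 1 else -1) else 0 := by
  unfold labellingDeg
  simp only [labelDeg_eq, mul_assoc]
  rw [← Finset.mul_sum]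
  congr 1
  unfold winding
  simp only [Finset.sum_mul]
  rw [Finset.sum_comm]
  refine Finset.sum_congr rfl fun e _ => ?_
  by_cases h : ∃ n, e.1 = rayEdge n
  · simp only [h, and_true, if_true, ite_mul, zero_mul]
    rw [Finset.sum_ite_eq, if_pos (Finset.mem_univ _)]
  · simp only [h, and_false, if_false, zero_mul, Finset.sum_const_zero]

theorem label_raise {u : D.State} {p : D.Crossing} (hp : u p = false) {T : Type*}
    {l : Circle u → T}
    (hl : l (circleOf u (D.arcAt p Dir.east)) = l (circleOf u (D.arcAt p Dir.west)))
    (e : D.Arc) : l (circleMap (raise u p) u (circleOf (raise u p) e)) = l (circleOf u e) := by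
  have huv := raise_off (u := u) (p := p)
  have hfl := circleOf_flip huv (raise_self hp)
  by_cases hm : circleOf u (D.arcAt p Dir.east) = circleOf u (D.arcAt p Dir.west)
  · rw [circleMap_circleOf (fun q hq => (huv q hq).symm) hm]
  · rw [← circleMap_circleOf huv (hfl.2 hm) e, label_circleMap huv (hfl.2 hm) hl]

theorem labellingDeg_raise {u : D.State} {p : D.Crossing} (hp : u p = false)
    {l : Circle u → Fin 2}
    (hl : l (circleOf u (D.arcAt p Dir.east)) = l (circleOf u (D.arcAt p Dir.west))) :
    labellingDeg (fun c => l (circleMap (raise u p) u c)) = labellingDeg l := by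
  rw [labellingDeg_eq, labellingDeg_eq]
  simp only [label_raise hp hl]

/-- The span of the elements of a family that have annular degree greater than `k`. -/
def higher {u : D.State} (F : (Circle u → Fin 2) → TQFTD u) (k : ℤ) :
    Submodule RαD (TQFTD u) := Submodule.span RαD (F '' {m | k < labellingDeg m})

theorem higher_mono {u : D.State} (F : (Circle u → Fin 2) → TQFTD u) {k k' : ℤ} (h : k ≤ k') :
    higher F k' ≤ higher F k :=
  Submodule.span_mono (Set.image_mono fun _ hm => lt_of_le_of_lt h hm)

theorem labelDeg_lt {u : D.State} {C : Circle u} {i j : Fin 2} (hij : i ≠ j) (h : Low C i) :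
    labelDeg C i < labelDeg C j := by
  unfold labelDeg
  rw [if_pos h.1, if_pos h.1, if_pos h, if_neg (not_low_of_low h hij)]
  decide

theorem sum_labelCoef_sub_mem {u : D.State} (F : (Circle u → Fin 2) → TQFTD u) (ε : ℤ)
    (l : Circle u → Fin 2) :
    ∑ m : Circle u → Fin 2, (∏ C, ((labelCoef ε C (l C) (m C) : ℤ) : RαD)) • F m - F l ∈
      higher F (labellingDeg l) := by
  classical
  rw [← Finset.add_sum_erase _ _ (Finset.mem_univ l)]
  have h1 : ∏ C, ((labelCoef ε C (l C) (l C) : ℤ) : RαD) = 1 :=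
    Finset.prod_eq_one fun C _ => by simp [labelCoef]
  rw [h1, one_smul, add_sub_cancel_left]
  refine Submodule.sum_mem _ fun m hm => ?_
  have hne := Finset.ne_of_mem_erase hm
  by_cases h : ∀ C, l C ≠ m C → Low C (l C)
  · refine Submodule.smul_mem _ _ (Submodule.subset_span ⟨m, ?_, rfl⟩)
    obtain ⟨C₀, hC₀⟩ := Function.ne_iff.1 hne.symm
    change labellingDeg l < labellingDeg m
    unfold labellingDeg
    refine Finset.sum_lt_sum (fun C _ => ?_) ⟨C₀, Finset.mem_univ _, labelDeg_lt hC₀ (h C₀ hC₀)⟩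
    by_cases hC : l C = m C
    · rw [hC]
    · exact (labelDeg_lt hC (h C hC)).le
  · push Not at h
    obtain ⟨C, hC, hL⟩ := h
    rw [Finset.prod_eq_zero (Finset.mem_univ C) (by simp [labelCoef, hC, hL]), zero_smul]
    exact Submodule.zero_mem _

theorem annularGenerator_sub_mem (u : D.State) (l : Circle u → Fin 2) :
    annularGenerator u l - planarGenerator u l ∈ higher (planarGenerator u) (labellingDeg l) := by
  rw [annularGenerator_eq_sum]
  exact sum_labelCoef_sub_mem _ _ _

theorem planarGenerator_sub_mem (u : D.State) (l : Circle u → Fin 2) :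
    planarGenerator u l - annularGenerator u l ∈
      higher (annularGenerator u) (labellingDeg l) := by
  rw [planarGenerator_eq_sum]
  exact sum_labelCoef_sub_mem _ _ _

theorem planarGenerator_mem_higher {u : D.State} {l : Circle u → Fin 2} {k : ℤ}
    (h : k < labellingDeg l) : planarGenerator u l ∈ higher (annularGenerator u) k := by
  rw [← sub_add_cancel (planarGenerator u l) (annularGenerator u l)]
  exact Submodule.add_mem _ (higher_mono _ h.le (planarGenerator_sub_mem u l))
    (Submodule.subset_span ⟨l, h, rfl⟩)

/-! ## The annular saddle maps -/

open scoped Classical in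
/-- The projection to annular degree `k`. -/
def adegProj (u : D.State) (k : ℤ) : TQFT u →ₗ[Rα] TQFT u :=
  (annularBasis u).constr Rα fun m => if adeg u m = k then annularBasis u m else 0

open scoped Classical in
theorem adegProj_basis (u : D.State) (k : ℤ) (m : Circle u → Fin 2) :
    adegProj u k (annularBasis u m) = if adeg u m = k then annularBasis u m else 0 :=
  Module.Basis.constr_basis _ _ _ _

theorem adegPart_comp_adegProj {u v : D.State} (f : TQFT u →ₗ[Rα] TQFT v) (k : ℤ) :
    adegPart f ∘ₗ adegProj u k = adegProj v k ∘ₗ f ∘ₗ adegProj u k := by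
  classical
  refine (annularBasis u).ext fun l => ?_
  simp only [LinearMap.comp_apply, adegProj_basis]
  split_ifs with h
  · rw [adegPart, Module.Basis.constr_basis]
    conv_rhs => rw [← (annularBasis v).sum_repr (f (annularBasis u l)), map_sum]
    refine Finset.sum_congr rfl fun m _ => ?_
    rw [map_smul, adegProj_basis, h]
    split_ifs
    · rfl
    · rw [smul_zero]
  · simp

theorem adegPart_baseChange {u v : D.State} (f : TQFT u →ₗ[Rα] TQFT v) {k : ℤ} {x : TQFTD u}
    (hx : (adegProj u k).baseChange RαD x = x) :
    (adegPart f).baseChange RαD x = (adegProj v k).baseChange RαD (f.baseChange RαD x) := by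
  have h := congrArg (fun g => g.baseChange RαD x) (adegPart_comp_adegProj f k)
  simpa only [LinearMap.baseChange_comp, LinearMap.comp_apply, hx] using h

theorem basisXSub_zero (r : Rα) : basisXSub r 0 = 1 := Module.Basis.mk_apply _ _ _

theorem basisXSub_one (r : Rα) : basisXSub r 1 = Xα - algebraMap Rα Aα r :=
  Module.Basis.mk_apply _ _ _

open scoped Classical in
theorem labelElement_of_isEssential {u : D.State} {C : Circle u} (h : IsEssential C) (i : Fin 2) :
    (labelElement C i).2 = circleBasis C (if Low C i then 0 else 1) := by
  rw [labelElement_eq]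
  unfold circleBasis Low
  by_cases h2 : Odd (essentialIndex C) <;> fin_cases i <;> simp only [h, h2] <;>
    simp [basisXSub_zero, basisXSub_one]

open scoped Classical in
theorem adegProj_annularGenerator (u : D.State) (k : ℤ) (l : Circle u → Fin 2) :
    (adegProj u k).baseChange RαD (annularGenerator u l) =
      if labellingDeg l = k then annularGenerator u l else 0 := by
  have key : adegProj u k (⨂ₜ[Rα] C, (labelElement C (l C)).2) =
      if labellingDeg l = k then ⨂ₜ[Rα] C, (labelElement C (l C)).2 else 0 := by
    have hterm : ∀ m : Circle u → Fin 2,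
        (annularBasis u).repr (⨂ₜ[Rα] C, (labelElement C (l C)).2) m ≠ 0 →
          adeg u m = labellingDeg l := by
      intro m hm
      rw [annularBasis, Basis.piTensorProduct_repr_tprod_apply, Finset.prod_ne_zero_iff] at hm
      refine Finset.sum_congr rfl fun C _ => ?_
      unfold labelDeg
      by_cases hC : IsEssential C
      · rw [if_pos hC, if_pos hC]
        have h1 := hm C (Finset.mem_univ C)
        rw [labelElement_of_isEssential hC, Module.Basis.repr_self, Finsupp.single_apply_ne_zero]
          at h1
        rw [h1.1]
        by_cases hL : Low C (l C)
        · simp [hL]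
        · simp [hL]
      · rw [if_neg hC, if_neg hC]
    conv_lhs => rw [← (annularBasis u).sum_repr (⨂ₜ[Rα] C, (labelElement C (l C)).2), map_sum]
    simp only [map_smul, adegProj_basis]
    split_ifs with hk
    · conv_rhs => rw [← (annularBasis u).sum_repr (⨂ₜ[Rα] C, (labelElement C (l C)).2)]
      refine Finset.sum_congr rfl fun m _ => ?_
      by_cases h0 : (annularBasis u).repr (⨂ₜ[Rα] C, (labelElement C (l C)).2) m = 0
      · rw [h0, zero_smul, zero_smul]
      · rw [if_pos ((hterm m h0).trans hk)]
    · refine Finset.sum_eq_zero fun m _ => ?_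
      by_cases h0 : (annularBasis u).repr (⨂ₜ[Rα] C, (labelElement C (l C)).2) m = 0
      · rw [h0, zero_smul]
      · rw [if_neg (fun h => hk ((hterm m h0).symm.trans h)), smul_zero]
  unfold annularGenerator pureTensor
  rw [LinearMap.baseChange_tmul, key]
  split_ifs
  · rfl
  · exact TensorProduct.tmul_zero _ _

theorem adegProj_higher {u : D.State} {k : ℤ} {x : TQFTD u}
    (hx : x ∈ higher (annularGenerator u) k) : (adegProj u k).baseChange RαD x = 0 := by
  classical
  have : higher (annularGenerator u) k ≤ LinearMap.ker ((adegProj u k).baseChange RαD) := by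
    refine Submodule.span_le.2 ?_
    rintro _ ⟨m, hm, rfl⟩
    change (adegProj u k).baseChange RαD _ = 0
    rw [adegProj_annularGenerator, if_neg (ne_of_gt hm)]
  exact this hx

open scoped Classical in
theorem annularSaddle_annularGenerator {u : D.State} {p : D.Crossing} (hp : u p = false)
    (l : Circle u → Fin 2) :
    (annularSaddle u p).baseChange RαD (annularGenerator u l) =
      if l (circleOf u (D.arcAt p Dir.east)) = l (circleOf u (D.arcAt p Dir.west)) then
        saddleCoef u p (l (circleOf u (D.arcAt p Dir.east))) •
          annularGenerator (raise u p) (fun c => l (circleMap (raise u p) u c))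
      else 0 := by
  have h0 : (adegProj u (labellingDeg l)).baseChange RαD (annularGenerator u l) =
      annularGenerator u l := by
    rw [adegProj_annularGenerator, if_pos rfl]
  unfold annularSaddle
  rw [adegPart_baseChange _ h0, ← add_sub_cancel (planarGenerator u l) (annularGenerator u l),
    map_add, map_add]
  have h1 : (saddle u p).baseChange RαD (annularGenerator u l - planarGenerator u l) ∈
      higher (annularGenerator (raise u p)) (labellingDeg l) := by
    have : higher (planarGenerator u) (labellingDeg l) ≤
        (higher (annularGenerator (raise u p)) (labellingDeg l)).comap
          ((saddle u p).baseChange RαD) := by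
      refine Submodule.span_le.2 ?_
      rintro _ ⟨m, hm, rfl⟩
      change (saddle u p).baseChange RαD _ ∈
        higher (annularGenerator (raise u p)) (labellingDeg l)
      rw [saddle_planarGenerator hp]
      split_ifs with hm'
      · refine Submodule.smul_mem _ _ (planarGenerator_mem_higher ?_)
        rw [labellingDeg_raise hp hm']
        exact hm
      · exact Submodule.zero_mem _
    exact this (annularGenerator_sub_mem u l)
  rw [adegProj_higher h1, add_zero, saddle_planarGenerator hp]
  split_ifs with hl
  · rw [map_smul]
    congr 1
    set l' : Circle (raise u p) → Fin 2 := fun c => l (circleMap (raise u p) u c)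
    have hd : labellingDeg l' = labellingDeg l := labellingDeg_raise hp hl
    rw [← sub_add_cancel (planarGenerator _ l') (annularGenerator _ l'), map_add,
      adegProj_higher (hd ▸ planarGenerator_sub_mem _ l'), zero_add,
      adegProj_annularGenerator, if_pos hd]
  · exact map_zero _

end AnnularDiagram

/-! ## Homogeneous elements -/

theorem IsHomogeneousRαD.mul {r r' : RαD} {k k' : ℤ} (h : IsHomogeneousRαD r k)
    (h' : IsHomogeneousRαD r' k') : IsHomogeneousRαD (r * r') (k + k') := by
  obtain ⟨n, m, f, hf, hk, hr⟩ := h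
  obtain ⟨n', m', f', hf', hk', hr'⟩ := h'
  refine ⟨n + n', m + m', f * f', hf.mul hf', ?_, ?_⟩
  · rw [hk, hk']
    push_cast
    ring
  · rw [pow_add, map_mul, map_mul, ← hr, ← hr']
    ring

theorem isHomogeneousRαD_algebraMap {f : Rα} {m : ℕ} (h : f.IsHomogeneous m) :
    IsHomogeneousRαD (algebraMap Rα RαD f) (2 * m) :=
  ⟨0, m, f, h, by simp, by simp⟩

theorem isHomogeneousRαD_intCast (z : ℤ) : IsHomogeneousRαD (z : RαD) 0 := by
  have h := isHomogeneousRαD_algebraMap (MvPolynomial.isHomogeneous_C (Fin 2) z)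
  simpa using h

theorem isHomogeneousRαD_α (i : Fin 2) : IsHomogeneousRαD (algebraMap Rα RαD (α i)) 2 :=
  isHomogeneousRαD_algebraMap (MvPolynomial.isHomogeneous_X ℤ i)

theorem isHomogeneousRαD_invDiff (i : Fin 2) : IsHomogeneousRαD (invDiff i) (-2) := by
  refine ⟨1, 1, diffα i, (MvPolynomial.isHomogeneous_X ℤ _).sub (MvPolynomial.isHomogeneous_X ℤ _),
    by norm_num, ?_⟩
  have h : discr ^ 1 = diffα i * diffα i := by
    unfold discr diffα
    fin_cases i
    · simp
      ring
    · simp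
      ring
  rw [h, map_mul, ← mul_assoc, invDiff_mul_diffα, one_mul]

theorem isHomogeneousRαD_prod {A : Type*} (t : Finset A) {r : A → RαD} {k : A → ℤ}
    (h : ∀ a ∈ t, IsHomogeneousRαD (r a) (k a)) :
    IsHomogeneousRαD (∏ a ∈ t, r a) (∑ a ∈ t, k a) := by
  classical
  induction t using Finset.induction_on with
  | empty => simpa using isHomogeneousRαD_intCast 1
  | insert a t ha ih =>
    rw [Finset.prod_insert ha, Finset.sum_insert ha]
    exact (h a (Finset.mem_insert_self _ _)).mul
      (ih fun b hb => h b (Finset.mem_insert_of_mem hb))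

namespace AnnularDiagram

variable {D : AnnularDiagram}

theorem isHomogeneousRαD_eVec (i m : Fin 2) :
    IsHomogeneousRαD (eVec i m) (if m = 0 then 0 else -2) := by
  fin_cases m
  · have h := (isHomogeneousRαD_intCast (-1)).mul
      ((isHomogeneousRαD_invDiff i).mul (isHomogeneousRαD_α i))
    simpa [eVec] using h
  · exact isHomogeneousRαD_invDiff i

theorem isHomogeneousRαD_stdCoef (j i : Fin 2) :
    IsHomogeneousRαD (stdCoef j i) (if j = 0 then 0 else 2) := by
  unfold stdCoef
  split_ifs
  · simpa using isHomogeneousRαD_intCast 1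
  · exact isHomogeneousRαD_α _

/-! ## The quantum grading in terms of the idempotents -/

theorem smul_planarGenerator_mem {u : D.State} {k : ℤ} {r : RαD}
    (hr : IsHomogeneousRαD r (k + Fintype.card (Circle u))) (l : Circle u → Fin 2) :
    r • planarGenerator u l ∈ qdegPiece u k := by
  rw [planarGenerator_eq_tensorVec, tensorVec, Finset.smul_sum]
  refine AddSubgroup.sum_mem _ fun m _ => AddSubgroup.subset_closure
    ⟨r * ∏ C, eVec (l C) (m C), _, m, hr.mul (isHomogeneousRαD_prod _ fun C _ =>
      isHomogeneousRαD_eVec (l C) (m C)), ?_, ?_⟩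
  · rw [add_assoc, ← Finset.sum_add_distrib]
    have h : ∀ C : Circle u, ((if m C = 0 then 0 else -2) + if m C = 0 then -1 else 1 : ℤ) = -1 := by
      intro C
      split_ifs <;> rfl
    rw [Finset.sum_congr rfl fun C _ => h C]
    simp
  · rw [smul_smul, TensorProduct.smul_tmul', smul_eq_mul, mul_one]

/-- The elements of quantum degree `k` are the sums of homogeneous multiples of the tensor
products of idempotents. -/
theorem qdegPiece_le {u : D.State} {k : ℤ} {S : AddSubgroup (TQFTD u)}
    (hS : ∀ (r : RαD) (l : Circle u → Fin 2),
      IsHomogeneousRαD r (k + Fintype.card (Circle u)) → r • planarGenerator u l ∈ S) :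
    qdegPiece u k ≤ S := by
  refine (AddSubgroup.closure_le _).2 ?_
  rintro _ ⟨r, j, l, hr, hk, rfl⟩
  have h1 : r ⊗ₜ[Rα] stdBasis u l = r • ((1 : RαD) ⊗ₜ[Rα] stdBasis u l) := by
    rw [TensorProduct.smul_tmul', smul_eq_mul, mul_one]
  rw [h1, stdBasis_eq_sum, Finset.smul_sum]
  refine AddSubgroup.sum_mem _ fun m _ => ?_
  rw [smul_smul]
  refine hS _ _ ?_
  convert hr.mul (isHomogeneousRαD_prod Finset.univ fun C _ =>
    isHomogeneousRαD_stdCoef (l C) (m C)) using 1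
  have h : ∀ C : Circle u, ((if l C = 0 then 0 else 2) : ℤ) =
      (if l C = 0 then -1 else 1) + 1 := by
    intro C
    split_ifs <;> rfl
  rw [hk, Finset.sum_congr rfl fun C _ => h C, Finset.sum_add_distrib]
  simp [add_assoc]

/-- The isomorphism that maps the element given by a labelling to the tensor product of
idempotents. -/
def labelEquiv (u : D.State) : TQFTD u ≃ₗ[RαD] TQFTD u :=
  (annularBasisD u).equiv (planarBasisD u) (Equiv.refl _)

theorem labelEquiv_annularGenerator (u : D.State) (l : Circle u → Fin 2) :
    labelEquiv u (annularGenerator u l) = planarGenerator u l := by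
  rw [← annularBasisD_apply, labelEquiv, Module.Basis.equiv_apply, planarBasisD_apply]
  rfl

theorem mem_qdegPiece_of_sum {u : D.State} (T : TQFTD u →ₗ[RαD] TQFTD u)
    (c : (Circle u → Fin 2) → (Circle u → Fin 2) → ℤ)
    (hT : ∀ l, T (planarGenerator u l) = ∑ m, ((c l m : ℤ) : RαD) • planarGenerator u m)
    {k : ℤ} {x : TQFTD u} (hx : x ∈ qdegPiece u k) : T x ∈ qdegPiece u k := by
  have h : qdegPiece u k ≤ (qdegPiece u k).comap T.toAddMonoidHom := by
    refine qdegPiece_le fun r l hr => ?_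
    change T (r • planarGenerator u l) ∈ qdegPiece u k
    rw [map_smul, hT, Finset.smul_sum]
    refine AddSubgroup.sum_mem _ fun m _ => ?_
    rw [smul_smul]
    refine smul_planarGenerator_mem ?_ m
    simpa using hr.mul (isHomogeneousRαD_intCast (c l m))
  exact h hx

theorem labelEquiv_mem_qdegPiece (u : D.State) (k : ℤ) (x : TQFTD u) :
    labelEquiv u x ∈ qdegPiece u k ↔ x ∈ qdegPiece u k := by
  constructor
  · intro h
    have := mem_qdegPiece_of_sum ((labelEquiv u).symm : TQFTD u →ₗ[RαD] TQFTD u)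
      (fun l m => ∏ C, labelCoef 1 C (l C) (m C)) ?_ h
    · simpa using this
    · intro l
      have h1 : ∑ m, ((∏ C, labelCoef 1 C (l C) (m C) : ℤ) : RαD) • planarGenerator u m =
          annularGenerator u l := by
        rw [annularGenerator_eq_sum]
        push_cast
        rfl
      rw [h1, LinearEquiv.coe_coe, LinearEquiv.symm_apply_eq, labelEquiv_annularGenerator]
  · refine mem_qdegPiece_of_sum (labelEquiv u : TQFTD u →ₗ[RαD] TQFTD u)
      (fun l m => ∏ C, labelCoef (-1) C (l C) (m C)) fun l => ?_
    conv_lhs => rw [planarGenerator_eq_sum]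
    rw [map_sum]
    refine Finset.sum_congr rfl fun m _ => ?_
    rw [map_smul, LinearEquiv.coe_coe, labelEquiv_annularGenerator]
    push_cast
    rfl

/-! ## Labellings of the edges -/

/-- The labelling of the circles of `D_u` that is induced by a labelling of the edges. -/
def circleLabel (u : D.State) (f : D.Arc → Fin 2) (C : Circle u) : Fin 2 := f (Quot.out C)

/-- A labelling of the edges that is constant on the circles of `D_u`. -/
def ConstOn (u : D.State) (f : D.Arc → Fin 2) : Prop := ∀ e, circleLabel u f (circleOf u e) = f e

theorem constOn_comp (u : D.State) (l : Circle u → Fin 2) :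
    ConstOn u (fun e => l (circleOf u e)) ∧ circleLabel u (fun e => l (circleOf u e)) = l := by
  have h : circleLabel u (fun e => l (circleOf u e)) = l :=
    funext fun C => congrArg l (circleOf_out C)
  exact ⟨fun e => by rw [h], h⟩

theorem circleLabel_raise {u : D.State} {f : D.Arc → Fin 2} (hf : ConstOn u f) (v : D.State) :
    (fun c => circleLabel u f (circleMap v u c)) = circleLabel v f :=
  funext fun _ => hf _

theorem ConstOn.raise {u : D.State} {f : D.Arc → Fin 2} (hf : ConstOn u f) {p : D.Crossing}
    (hp : u p = false) (h : f (D.arcAt p Dir.east) = f (D.arcAt p Dir.west)) :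
    ConstOn (raise u p) f := by
  intro e
  rw [← circleLabel_raise hf]
  refine (label_raise hp ?_ e).trans (hf e)
  rw [hf, hf, h]

/-- The number of circles with a given label. -/
def labelCount (u : D.State) (f : D.Arc → Fin 2) (i : Fin 2) : ℕ :=
  ∑ C : Circle u, if circleLabel u f C = i then 1 else 0

open scoped Classical in
theorem labelCount_raise {u : D.State} {f : D.Arc → Fin 2} (hf : ConstOn u f) {p : D.Crossing}
    (hp : u p = false) (h : f (D.arcAt p Dir.east) = f (D.arcAt p Dir.west)) (i : Fin 2) :
    labelCount (raise u p) f i + (if f (D.arcAt p Dir.east) = i then 1 else 0) =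
      labelCount u f i +
        (if circleOf u (D.arcAt p Dir.east) = circleOf u (D.arcAt p Dir.west) then
          (if f (D.arcAt p Dir.east) = i then 2 else 0) else 0) := by
  have hfv := hf.raise hp h
  have huv := raise_off (u := u) (p := p)
  have hfl := circleOf_flip huv (raise_self hp)
  set v := raise u p with hv
  unfold labelCount
  by_cases hm : circleOf u (D.arcAt p Dir.east) = circleOf u (D.arcAt p Dir.west)
  · have hvu : ∀ q, q ≠ p → v q = u q := fun q hq => (huv q hq).symm
    have hne : circleOf v (D.arcAt p Dir.east) ≠ circleOf v (D.arcAt p Dir.west) :=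
      fun h => hfl.1 h hm
    have h1 := sum_comp_of_merge (circleMap_surjective hvu hm) hne
      ((circleMap_circleOf hvu hm _).trans (hm.trans (circleMap_circleOf hvu hm _).symm))
      (fun k k' h => circleMap_eq hvu h) (fun C => if circleLabel u f C = i then 1 else 0)
    have h2 := fun c => congrFun (circleLabel_raise hf v) c
    simp only [h2] at h1
    rw [h1, hfv, if_pos hm]
    split_ifs <;> ring
  · have hmv := hfl.2 hm
    have h1 := sum_comp_of_merge (circleMap_surjective huv hmv) hm
      ((circleMap_circleOf huv hmv _).trans (hmv.trans (circleMap_circleOf huv hmv _).symm))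
      (fun k k' h => circleMap_eq huv h) (fun C => if circleLabel v f C = i then 1 else 0)
    have h2 := fun c => congrFun (circleLabel_raise hfv u) c
    simp only [h2] at h1
    rw [h1, hf, if_neg hm]
    ring

theorem raise_of_ne {u : D.State} {p q : D.Crossing} (h : p ≠ q) : raise u p q = u q :=
  Function.update_of_ne h.symm _ _

theorem raise_comm (u : D.State) (p q : D.Crossing) :
    raise (raise u p) q = raise (raise u q) p := by
  by_cases h : p = q
  · rw [h]
  · exact Function.update_comm h _ _ _

theorem saddleCoef_comm {u : D.State} {f : D.Arc → Fin 2} (hf : ConstOn u f) {p q : D.Crossing}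
    (hpq : p ≠ q) (hp : u p = false) (hq : u q = false)
    (hfp : f (D.arcAt p Dir.east) = f (D.arcAt p Dir.west))
    (hfq : f (D.arcAt q Dir.east) = f (D.arcAt q Dir.west)) :
    saddleCoef u p (f (D.arcAt p Dir.east)) *
        saddleCoef (raise u p) q (f (D.arcAt q Dir.east)) =
      saddleCoef u q (f (D.arcAt q Dir.east)) *
        saddleCoef (raise u q) p (f (D.arcAt p Dir.east)) := by
  have h1 := labelCount_raise hf hp hfp
  have h2 := labelCount_raise (hf.raise hp hfp) ((raise_of_ne hpq).trans hq) hfq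
  have h3 := labelCount_raise hf hq hfq
  have h4 := labelCount_raise (hf.raise hq hfq) ((raise_of_ne hpq.symm).trans hp) hfp
  rw [raise_comm] at h2
  unfold saddleCoef
  generalize f (D.arcAt p Dir.east) = a at *
  generalize f (D.arcAt q Dir.east) = b at *
  have h1a := h1 a
  have h2a := h2 a
  have h3a := h3 a
  have h4a := h4 a
  have h1b := h1 b
  have h2b := h2 b
  have h3b := h3 b
  have h4b := h4 b
  clear h1 h2 h3 h4
  by_cases hab : a = b
  · subst hab
    simp only [if_true] at *
    split_ifs at * <;> first | omega | ring
  · have hba : b ≠ a := Ne.symm hab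
    simp only [if_true, hab, hba, if_false, ite_self] at *
    split_ifs at * <;> first | omega | ring

/-! ## The complexes -/

/-- The maps `g` act on the elements `B` given by labellings in the same way as the saddle maps of
the planar theory act on the tensor products of idempotents. -/
def ActsBySaddles (B : ∀ u : D.State, (Circle u → Fin 2) → TQFTD u)
    (g : ∀ (u : D.State) (p : D.Crossing), TQFT u →ₗ[Rα] TQFT (raise u p)) : Prop :=
  ∀ (u : D.State) (p : D.Crossing), u p = false → ∀ l : Circle u → Fin 2,
    (g u p).baseChange RαD (B u l) =
      if l (circleOf u (D.arcAt p Dir.east)) = l (circleOf u (D.arcAt p Dir.west)) then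
        saddleCoef u p (l (circleOf u (D.arcAt p Dir.east))) •
          B (raise u p) (fun c => l (circleMap (raise u p) u c))
      else 0

theorem actsBySaddles_planar : ActsBySaddles (D := D) planarGenerator saddle := by
  intro u p hp l
  convert saddle_planarGenerator hp l

theorem actsBySaddles_annular : ActsBySaddles (D := D) annularGenerator annularSaddle := by
  intro u p hp l
  convert annularSaddle_annularGenerator hp l

open scoped Classical in
/-- The chain given by a labelling of the edges at the vertex `w` of the cube; it is zero if `w`
does not contribute to homological degree `i`. -/
def generatorChain (B : ∀ u : D.State, (Circle u → Fin 2) → TQFTD u) (i : ℤ) (w : D.State)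
    (f : D.Arc → Fin 2) : D.Chain i :=
  if h : (D.weight w : ℤ) = i + D.nMinus then
    inclusion (⟨w, h⟩ : D.StateInDegree i) (B w (circleLabel w f))
  else 0

theorem generatorChain_of {B : ∀ u : D.State, (Circle u → Fin 2) → TQFTD u} {i : ℤ}
    (u : D.StateInDegree i) (f : D.Arc → Fin 2) :
    generatorChain B i u.1 f = inclusion u (B u.1 (circleLabel u.1 f)) := dif_pos u.2

theorem cubeDiff_inclusion (s : D.SignAssignment)
    (g : ∀ (u : D.State) (p : D.Crossing), TQFT u →ₗ[Rα] TQFT (raise u p)) {i : ℤ}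
    (u : D.StateInDegree i) (x : TQFTD u.1) :
    cubeDiff s g i (inclusion u x) = ∑ p : {p : D.Crossing // u.1 p = false},
      ((s.sign u.1 p.1 : ℤ) : RαD) • inclusion (u.raise p) ((g u.1 p.1).baseChange RαD x) := by
  unfold cubeDiff inclusion
  rw [DirectSum.toModule_lof, LinearMap.sum_apply]
  rfl

/-- The coefficient of the edge at `p` in the differential. -/
def edgeCoef (s : D.SignAssignment) (f : D.Arc → Fin 2) (w : D.State) (p : D.Crossing) : RαD :=
  if w p = false ∧ f (D.arcAt p Dir.east) = f (D.arcAt p Dir.west) then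
    ((s.sign w p : ℤ) : RαD) * saddleCoef w p (f (D.arcAt p Dir.east))
  else 0

theorem cubeDiff_generatorChain (s : D.SignAssignment)
    {B : ∀ u : D.State, (Circle u → Fin 2) → TQFTD u}
    {g : ∀ (u : D.State) (p : D.Crossing), TQFT u →ₗ[Rα] TQFT (raise u p)}
    (hBg : ActsBySaddles B g) (i : ℤ) {w : D.State} {f : D.Arc → Fin 2} (hf : ConstOn w f) :
    cubeDiff s g i (generatorChain B i w f) =
      ∑ p, edgeCoef s f w p • generatorChain B (i + 1) (raise w p) f := by
  classical
  by_cases h : (D.weight w : ℤ) = i + D.nMinus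
  · have h1 := generatorChain_of (B := B) (⟨w, h⟩ : D.StateInDegree i) f
    refine (congrArg _ h1).trans ((cubeDiff_inclusion s g _ _).trans ?_)
    have h2 : ∀ p : {p : D.Crossing // w p = false},
        ((s.sign w p.1 : ℤ) : RαD) • inclusion (StateInDegree.raise ⟨w, h⟩ p)
          ((g w p.1).baseChange RαD (B w (circleLabel w f))) =
        edgeCoef s f w p.1 • generatorChain B (i + 1) (raise w p.1) f := by
      rintro ⟨p, hp⟩
      have h3 := generatorChain_of (B := B)
        (StateInDegree.raise (⟨w, h⟩ : D.StateInDegree i) ⟨p, hp⟩) f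
      change generatorChain B (i + 1) (raise w p) f = _ at h3
      rw [h3, hBg w p hp, hf, hf, circleLabel_raise hf]
      unfold edgeCoef
      by_cases hfp : f (D.arcAt p Dir.east) = f (D.arcAt p Dir.west)
      · rw [if_pos hfp, if_pos ⟨hp, hfp⟩]
        exact (congrArg _ (LinearMap.map_smul _ _ _)).trans (smul_smul _ _ _)
      · rw [if_neg hfp, if_neg (fun h => hfp h.2)]
        exact ((congrArg _ (LinearMap.map_zero _)).trans (smul_zero _)).trans
          (zero_smul _ _).symm
    rw [Finset.sum_congr rfl fun p _ => h2 p,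
      ← Finset.sum_subtype (Finset.univ.filter fun p => w p = false) (by simp)
        (fun p => edgeCoef s f w p • generatorChain B (i + 1) (raise w p) f),
      Finset.sum_filter]
    refine Finset.sum_congr rfl fun p _ => ?_
    split_ifs with hp
    · rfl
    · rw [edgeCoef, if_neg (fun h => hp h.1), zero_smul]
  · rw [generatorChain, dif_neg h, map_zero]
    refine (Finset.sum_eq_zero fun p _ => ?_).symm
    by_cases hp : w p = false
    · rw [generatorChain, dif_neg, smul_zero]
      rw [weight_raise hp]
      push_cast
      exact fun h' => h (by linarith)
    · rw [edgeCoef, if_neg (fun h => hp h.1), zero_smul]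

theorem edgeCoef_anticomm (s : D.SignAssignment) {f : D.Arc → Fin 2} {w : D.State}
    (hf : ConstOn w f) {p q : D.Crossing} (hpq : p ≠ q) :
    edgeCoef s f w p * edgeCoef s f (raise w p) q =
      -(edgeCoef s f w q * edgeCoef s f (raise w q) p) := by
  unfold edgeCoef
  rw [raise_of_ne hpq, raise_of_ne hpq.symm]
  by_cases h1 : w p = false ∧ f (D.arcAt p Dir.east) = f (D.arcAt p Dir.west)
  · by_cases h2 : w q = false ∧ f (D.arcAt q Dir.east) = f (D.arcAt q Dir.west)
    · rw [if_pos h1, if_pos h2, if_pos h2, if_pos h1]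
      have h3 := saddleCoef_comm hf hpq h1.1 h2.1 h1.2 h2.2
      have h4 := congrArg (fun z : ℤˣ => ((z : ℤ) : RαD)) (s.anticomm w p q hpq h1.1 h2.1)
      simp only [Units.val_mul, Units.val_neg, Int.cast_mul, Int.cast_neg] at h4
      rw [mul_mul_mul_comm, h3, h4, mul_mul_mul_comm, neg_mul]
    · rw [if_neg h2, if_neg h2, mul_zero, zero_mul, neg_zero]
  · rw [if_neg h1, if_neg h1, mul_zero, zero_mul, neg_zero]

theorem edgeCoef_self (s : D.SignAssignment) (f : D.Arc → Fin 2) (w : D.State)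
    (p : D.Crossing) : edgeCoef s f (raise w p) p = 0 := by
  refine if_neg fun h => ?_
  have : raise w p p = true := Function.update_self _ _ _
  rw [this] at h
  exact absurd h.1 (by decide)

theorem cubeDiff_cubeDiff_generatorChain (s : D.SignAssignment)
    {B : ∀ u : D.State, (Circle u → Fin 2) → TQFTD u}
    {g : ∀ (u : D.State) (p : D.Crossing), TQFT u →ₗ[Rα] TQFT (raise u p)}
    (hBg : ActsBySaddles B g) (i : ℤ) {w : D.State} {f : D.Arc → Fin 2} (hf : ConstOn w f) :
    cubeDiff s g (i + 1) (cubeDiff s g i (generatorChain B i w f)) = 0 := by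
  rw [cubeDiff_generatorChain s hBg i hf, map_sum]
  have h1 : ∀ p, cubeDiff s g (i + 1)
      (edgeCoef s f w p • generatorChain B (i + 1) (raise w p) f) =
        ∑ q, (edgeCoef s f w p * edgeCoef s f (raise w p) q) •
          generatorChain B (i + 1 + 1) (raise (raise w p) q) f := by
    intro p
    rw [map_smul]
    by_cases hp : w p = false ∧ f (D.arcAt p Dir.east) = f (D.arcAt p Dir.west)
    · rw [cubeDiff_generatorChain s hBg (i + 1) (hf.raise hp.1 hp.2), Finset.smul_sum]
      simp only [smul_smul]
    · have : edgeCoef s f w p = 0 := if_neg hp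
      simp only [this, zero_smul, zero_mul, Finset.sum_const_zero]
  simp only [h1]
  rw [← Fintype.sum_prod_type' (f := fun p q =>
    (edgeCoef s f w p * edgeCoef s f (raise w p) q) •
      generatorChain B (i + 1 + 1) (raise (raise w p) q) f)]
  refine Finset.sum_involution (fun x _ => x.swap) ?_ ?_ (fun _ _ => Finset.mem_univ _)
    (fun x _ => x.swap_swap)
  · rintro ⟨p, q⟩ -
    simp only [Prod.fst_swap, Prod.snd_swap]
    by_cases hpq : p = q
    · subst hpq
      rw [edgeCoef_self, mul_zero, zero_smul, add_zero]
    · rw [edgeCoef_anticomm s hf hpq, raise_comm, ← add_smul, neg_add_cancel, zero_smul]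
  · rintro ⟨p, q⟩ - h0 h
    apply h0
    have hpq : q = p := congrArg Prod.fst h
    subst hpq
    simp only
    rw [edgeCoef_self, mul_zero, zero_smul]

/-- Two linear maps on chains agree if they agree on the elements given by labellings. -/
theorem chain_ext {N : Type*} [AddCommMonoid N] [Module RαD N] {i : ℤ}
    {B : ∀ u : D.State, (Circle u → Fin 2) → TQFTD u}
    (hB : ∀ u, Submodule.span RαD (Set.range (B u)) = ⊤) {T T' : D.Chain i →ₗ[RαD] N}
    (h : ∀ (u : D.StateInDegree i) (f : D.Arc → Fin 2), ConstOn u.1 f →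
      T (generatorChain B i u.1 f) = T' (generatorChain B i u.1 f)) : T = T' := by
  refine DirectSum.linearMap_ext RαD fun u => ?_
  refine LinearMap.ext_on_range (hB u.1) fun l => ?_
  obtain ⟨h1, h2⟩ := constOn_comp u.1 l
  have h3 := h u _ h1
  rw [generatorChain_of, h2] at h3
  exact h3

theorem planarDiff_comp (s : D.SignAssignment) (i : ℤ) :
    planarDiff s (i + 1) ∘ₗ planarDiff s i = 0 :=
  chain_ext planarGenerator_span fun _ _ hf =>
    cubeDiff_cubeDiff_generatorChain s actsBySaddles_planar i hf

theorem annularDiff_comp (s : D.SignAssignment) (i : ℤ) :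
    annularDiff s (i + 1) ∘ₗ annularDiff s i = 0 :=
  chain_ext annularGenerator_span fun _ _ hf =>
    cubeDiff_cubeDiff_generatorChain s actsBySaddles_annular i hf

variable (D) in
/-- The isomorphism from the annular to the planar complex. -/
def chainEquiv (i : ℤ) : D.Chain i ≃ₗ[RαD] D.Chain i :=
  DFinsupp.mapRange.linearEquiv fun u : D.StateInDegree i => labelEquiv u.1

theorem chainEquiv_apply {i : ℤ} (x : D.Chain i) (u : D.StateInDegree i) :
    D.chainEquiv i x u = labelEquiv u.1 (x u) :=
  DFinsupp.mapRange_apply _ (fun _ => map_zero _) _ _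

theorem chainEquiv_inclusion {i : ℤ} (u : D.StateInDegree i) (l : Circle u.1 → Fin 2) :
    D.chainEquiv i (inclusion u (annularGenerator u.1 l)) =
      inclusion u (planarGenerator u.1 l) := by
  rw [← labelEquiv_annularGenerator]
  exact DFinsupp.mapRange_single (hf := fun _ => map_zero _)

theorem chainEquiv_generatorChain (i : ℤ) (w : D.State) (f : D.Arc → Fin 2) :
    D.chainEquiv i (generatorChain annularGenerator i w f) =
      generatorChain planarGenerator i w f := by
  unfold generatorChain
  split_ifs with h
  · exact chainEquiv_inclusion _ _
  · exact map_zero _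

theorem chainEquiv_comp_annularDiff (s : D.SignAssignment) (i : ℤ) :
    (D.chainEquiv (i + 1)).toLinearMap ∘ₗ annularDiff s i =
      planarDiff s i ∘ₗ (D.chainEquiv i).toLinearMap := by
  refine chain_ext annularGenerator_span fun u f hf => ?_
  simp only [LinearMap.comp_apply, LinearEquiv.coe_coe, chainEquiv_generatorChain]
  unfold annularDiff planarDiff
  rw [cubeDiff_generatorChain s actsBySaddles_annular i hf,
    cubeDiff_generatorChain s actsBySaddles_planar i hf, map_sum]
  simp only [map_smul, chainEquiv_generatorChain]

end AnnularDiagram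

end

theorem mainTheorem2 (D : AnnularDiagram) (s : D.SignAssignment) :
    (∀ i : ℤ, AnnularDiagram.planarDiff s (i + 1) ∘ₗ AnnularDiagram.planarDiff s i = 0) ∧
    (∀ i : ℤ, AnnularDiagram.annularDiff s (i + 1) ∘ₗ AnnularDiagram.annularDiff s i = 0) ∧
    (∀ u : D.State,
      LinearIndependent RαD (AnnularDiagram.annularGenerator u) ∧
      Submodule.span RαD (Set.range (AnnularDiagram.annularGenerator u)) = ⊤ ∧
      LinearIndependent RαD (AnnularDiagram.planarGenerator u) ∧
      Submodule.span RαD (Set.range (AnnularDiagram.planarGenerator u)) = ⊤) ∧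
    ∃ φ : ∀ i : ℤ, D.Chain i ≃ₗ[RαD] D.Chain i,
      (∀ (i : ℤ) (x : D.Chain i),
        φ (i + 1) (AnnularDiagram.annularDiff s i x) = AnnularDiagram.planarDiff s i (φ i x)) ∧
      (∀ (i k : ℤ) (x : D.Chain i),
        AnnularDiagram.HasQdeg k (φ i x) ↔ AnnularDiagram.HasQdeg k x) ∧
      (∀ (i : ℤ) (u : D.StateInDegree i) (l : AnnularDiagram.Circle u.1 → Fin 2),
        φ i (AnnularDiagram.inclusion u (AnnularDiagram.annularGenerator u.1 l)) =
          AnnularDiagram.inclusion u (AnnularDiagram.planarGenerator u.1 l)) := by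
  refine ⟨AnnularDiagram.planarDiff_comp s, AnnularDiagram.annularDiff_comp s, fun u =>
    ⟨AnnularDiagram.linearIndependent_of_span (AnnularDiagram.annularGenerator_span u),
      AnnularDiagram.annularGenerator_span u,
      AnnularDiagram.linearIndependent_of_span (AnnularDiagram.planarGenerator_span u),
      AnnularDiagram.planarGenerator_span u⟩, D.chainEquiv, fun i x => ?_, fun i k x => ?_,
    fun i u l => AnnularDiagram.chainEquiv_inclusion u l⟩
  · exact congrArg (fun T => T x) (AnnularDiagram.chainEquiv_comp_annularDiff s i)
  · unfold AnnularDiagram.HasQdeg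
    refine forall_congr' fun u => ?_
    rw [AnnularDiagram.chainEquiv_apply]
    exact AnnularDiagram.labelEquiv_mem_qdegPiece _ _ _
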